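/- Let $\Omega$ be a nonempty set (states), $\mathbb K$ a nonempty set of maps $z:\mathbb R_{\ge 0}\to\Omega$ (processes), and $g:\Omega\to[0,1]$ a function such that $t\mapsto g(z(t))$ is Lebesgue measurable for every $z\in\mathbb K$. Let $\mathfrak C$ and $\mathfrak U$ be the sets of all bounded real functions on $\mathbb K$ and on $\Omega$ respectively. A *game map* is a map $\mathbb V:\mathfrak C\to\mathfrak U$ such that $\mathbb V[Ac+B]=A\,\mathbb V[c]+B$ for all $c\in\mathfrak C$, $A\ge 0$, $B\in\mathbb R$, and such that $c_1\le c_2$ on $\mathbb K$ implies $\mathbb V[c_1]\le\mathbb V[c_2]$ on $\Omega$. Let $\mathfrak D$ be the set of all probability densities $\varrho:\mathbb R_{\ge0}\to\mathbb R_{\ge0}$. For $\varrho\in\mathfrak D$ put $\mathfrak c[\varrho](z)=\int_0^\infty\varrho(t)g(z(t))\,dt$ for $z\in\mathbb K$, and $\mathcal V[\varrho]=\mathbb V\big[\mathfrak c[\varrho]\big]$. For $\lambda>0$ let $\varrho^{\lambda}_{\mathrm{scale}}(t)=\lambda\varrho(\lambda t)$, and for $T>0$ with $\int_T^\infty\varrho(s)\,ds>0$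 let $\varrho^{T}_{\mathrm{shift}}(t)=\varrho(t+T)/\int_T^\infty\varrho(s)\,ds$. Let $\varpi_T=\frac1T 1_{[0,T]}$ and $\pi_\lambda(t)=\lambda e^{-\lambda t}$ for $T,\lambda>0$. A density $\varrho\in\mathfrak D$ is called a *power density* if, for some $\alpha,\beta,\gamma>0$, $\varrho(t)=(\alpha+\beta t)^{-\gamma}$ for all $t\ge0$. A density is called *piecewise continuous on* $(0,\infty)$ if it has only finitely many discontinuities in each compact subinterval of $(0,\infty)$ and finite one-sided limits at every point of $(0,\infty)$. **Theorem.** Let $\mathbb V$ be a game map that satisfies the discrete dynamic programming principle: for every $\varrho\in\mathfrak D$ and every integer $n\ge1$ with $\int_n^\infty\varrho(t)\,dt>0$, the map $\mathbb V$ takes the same value at the payoff $\mathfrak c[\varrho]$ and at the payoff $$z\mapsto\int_0^n\varrho(t)g(z(t))\,dt+\int_n^\infty\varrho(t)\,dt\cdot\mathcal V\big[\varrho^{n}_{\mathrm{shift}}\big](z(n)).$$ Suppose also that $z(n+s)=z(n)$ for all $z\in\mathbb K$, all integers $n\ge0$ and all $s\in(0,1)$. Let $U_*:\Omega\to[0,1]$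 be an arbitrary function. Then each of the following conditions (c), (u), (e), (p), (q) is equivalent to the condition * $(u')$ $\mathcal V[\varpi_n]\to U_*$ uniformly on $\Omega$ as $n\to\infty$, $n\in\mathbb N$: * $(c)$ for every density $\mu\in\mathfrak D$ that is piecewise continuous on $(0,\infty)$, $\mathcal V[\mu^{\lambda}_{\mathrm{scale}}]\to U_*$ uniformly on $\Omega$ as $\lambda\to+0$; * $(u)$ $\mathcal V[\varpi_T]\to U_*$ uniformly on $\Omega$ as $T\to+\infty$, $T\in\mathbb R$; * $(e)$ $\mathcal V[\pi_\lambda]\to U_*$ uniformly on $\Omega$ as $\lambda\to+0$; * $(p)$ for some power density $\varrho\in\mathfrak D$, $\mathcal V[\varrho^{T}_{\mathrm{shift}}]\to U_*$ uniformly on $\Omega$ as $T\to+\infty$; * $(q)$ for every power density $\varrho\in\mathfrak D$, $\mathcal V[\varrho^{T}_{\mathrm{shift}}]\to U_*$ uniformly on $\Omega$ as $T\to+\infty$. -/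

import Mathlib

open Set Filter Topology MeasureTheory
open scoped NNReal

noncomputable section

namespace TauberianGame

/-- A bounded real function (a payoff on the set of processes, or a value on the set of states). -/
def IsBdd {X : Type*} (f : X → ℝ) : Prop := ∃ C : ℝ, ∀ x, |f x| ≤ C

/-- Probability densities on `[0, ∞)`. Only the restriction of `ρ` to `[0, ∞)` matters:
values at negative arguments never enter any of the notions below. -/
structure IsDensity (ρ : ℝ → ℝ) : Prop where
  nonneg : ∀ t, 0 ≤ t → 0 ≤ ρ t
  integrable : IntegrableOn ρ (Ioi 0)
  integral_eq_one : ∫ t in Ioi (0 : ℝ), ρ t = 1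

/-- The shifted density `t ↦ ρ (t + T) / ∫_T^∞ ρ` (meaningful when the tail integral is positive). -/
def shift (ρ : ℝ → ℝ) (T : ℝ) : ℝ → ℝ := fun t => ρ (t + T) / ∫ s in Ioi T, ρ s

/-- The rescaled density `t ↦ l * ρ (l * t)` (meaningful for `l > 0`). -/
def scale (ρ : ℝ → ℝ) (l : ℝ) : ℝ → ℝ := fun t => l * ρ (l * t)

/-- The density of the uniform distribution on `[0, T]`, `T > 0`. -/
def uniformDensity (T : ℝ) : ℝ → ℝ := (Icc 0 T).indicator fun _ => 1 / T

/-- The density of the exponential distribution with rate `l > 0`. -/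
def expDensity (l : ℝ) : ℝ → ℝ := fun t => l * Real.exp (-(l * t))

/-- Power densities: densities of the form `(α + β t) ^ (-γ)` on `[0, ∞)`, `α, β, γ > 0`. -/
def IsPowerDensity (ρ : ℝ → ℝ) : Prop :=
  IsDensity ρ ∧ ∃ α β γ : ℝ, 0 < α ∧ 0 < β ∧ 0 < γ ∧ ∀ t, 0 ≤ t → ρ t = 1 / (α + β * t) ^ γ

/-- Piecewise continuity on `(0, ∞)`: finitely many discontinuities on every compact subinterval
of `(0, ∞)`, and finite one-sided limits at every point. -/
def PiecewiseContinuous (ρ : ℝ → ℝ) : Prop :=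
  (∀ a b : ℝ, 0 < a → a ≤ b → {t ∈ Icc a b | ¬ ContinuousAt ρ t}.Finite) ∧
  ∀ t, 0 < t → (∃ l, Tendsto ρ (𝓝[<] t) (𝓝 l)) ∧ ∃ r, Tendsto ρ (𝓝[>] t) (𝓝 r)

variable {Ω : Type*} {K : Set (ℝ≥0 → Ω)}

/-- A game map sends bounded payoffs on the set `K` of processes to bounded functions on the set of
states, is positively homogeneous and commutes with adding constants, and is monotone.
Its values at unbounded functions are irrelevant. -/
structure IsGameMap (V : (K → ℝ) → Ω → ℝ) : Prop where
  bounded : ∀ c, IsBdd c → IsBdd (V c)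
  affine : ∀ c, IsBdd c → ∀ A B : ℝ, 0 ≤ A → ∀ ω, V (fun z => A * c z + B) ω = A * V c ω + B
  mono : ∀ c₁ c₂, IsBdd c₁ → IsBdd c₂ → (∀ z, c₁ z ≤ c₂ z) → ∀ ω, V c₁ ω ≤ V c₂ ω

/-- The payoff of a process averaged with the density `ρ`: `∫_0^∞ ρ(t) g(z(t)) dt`. -/
def payoff (g : Ω → ℝ) (ρ : ℝ → ℝ) (z : ℝ≥0 → Ω) : ℝ :=
  ∫ t in Ioi (0 : ℝ), ρ t * g (z t.toNNReal)

/-- The value function of the game whose payoff is averaged with the density `ρ`. -/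
def value (V : (K → ℝ) → Ω → ℝ) (g : Ω → ℝ) (ρ : ℝ → ℝ) : Ω → ℝ :=
  V fun z => payoff g ρ z

/-- The payoff that is collected up to time `T` and continued by the value at the state `z(T)`:
`∫_0^T ρ(t) g(z(t)) dt + (∫_T^∞ ρ) * value of the shifted density at z(T)`. -/
def stoppedPayoff (V : (K → ℝ) → Ω → ℝ) (g : Ω → ℝ) (ρ : ℝ → ℝ) (T : ℝ≥0) (z : K) : ℝ :=
  (∫ t in Ioc (0 : ℝ) T, ρ t * g (z.1 t.toNNReal)) +
    (∫ t in Ioi (T : ℝ), ρ t) * value V g (shift ρ T) (z.1 T)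

/-- The discrete dynamic programming principle: at all integer times `n ≥ 1`. -/
def DiscreteDPP (V : (K → ℝ) → Ω → ℝ) (g : Ω → ℝ) : Prop :=
  ∀ ρ : ℝ → ℝ, IsDensity ρ → ∀ n : ℕ, 1 ≤ n → 0 < ∫ t in Ioi (n : ℝ), ρ t →
    V (stoppedPayoff V g ρ n) = V fun z => payoff g ρ z

end TauberianGame

end

open TauberianGame

/-! Call a density Tauberian if the values of its rescalings `scale ρ l` converge uniformly to `U`
as `l → 0+` (`IsTauberian`). Each condition of the theorem amounts to certain densities being
Tauberian, and the uniform density is the hub: it is Tauberian under any of the conditions, and once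
it is, so is every density.

Two closure properties carry the proof. A game map is nonexpansive in the sup norm and rescaling is
an `L¹` isometry, so the Tauberian densities are `L¹`-closed (`isTauberian_of_forall_l1dist_le`).
The dynamic programming principle allows gluing at a time `h` (`IsTauberian.of_eqOn_Ioc`): integer
times suffice, because stopping `scale ρ l` at `⌊h / l⌋₊` stops `ρ` at `l * ⌊h / l⌋₊ → h`, and
shifts are `L¹`-continuous in the time.

From the uniform density to all: the first step of a step density is an initial piece of a uniform
density, so gluing and induction on the number of steps apply (`isTauberian_of_step`), and step
densities are dense.

From exponential or power densities to the uniform one: their shifts are rescalings of themselves,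
hence Tauberian. Gluing a short, nearly constant initial piece to a Tauberian density contracts its
distance to the uniform density up to a relatively small error, so the infimum of such distances is
zero (`isTauberian_uniformDensity_one`). -/

namespace TauberianGame

/-! ### `L¹` estimates for shifted and rescaled densities -/

/-- The `L¹` distance on `(0, ∞)`. -/
noncomputable def l1dist (f g : ℝ → ℝ) : ℝ := ∫ t in Ioi (0 : ℝ), |f t - g t|

theorem l1dist_nonneg (f g : ℝ → ℝ) : 0 ≤ l1dist f g :=
  integral_nonneg fun _ => abs_nonneg _

theorem l1dist_triangle {f g k : ℝ → ℝ} (hf : IntegrableOn f (Ioi 0)) (hg : IntegrableOn g (Ioi 0))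
    (hk : IntegrableOn k (Ioi 0)) : l1dist f k ≤ l1dist f g + l1dist g k := by
  unfold l1dist
  have h := integral_mono (hf.sub hk).abs ((hf.sub hg).abs.add (hg.sub hk).abs)
    fun t => abs_sub_le (f t) (g t) (k t)
  exact h.trans_eq (integral_add (hf.sub hg).abs (hg.sub hk).abs)

theorem l1dist_congr {f f' g g' : ℝ → ℝ} (hf : EqOn f f' (Ioi 0)) (hg : EqOn g g' (Ioi 0)) :
    l1dist f g = l1dist f' g' :=
  setIntegral_congr_fun measurableSet_Ioi fun t ht => by simp only [hf ht, hg ht]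

theorem l1dist_eq_zero_of_eqOn {f g : ℝ → ℝ} (h : EqOn f g (Ioi 0)) : l1dist f g = 0 := by
  rw [l1dist_congr h (fun _ _ => rfl : EqOn g g (Ioi 0))]
  simp [l1dist]

theorem l1dist_eq_add {f g : ℝ → ℝ} (hf : IntegrableOn f (Ioi 0)) (hg : IntegrableOn g (Ioi 0))
    {h : ℝ} (hh : 0 ≤ h) :
    l1dist f g = (∫ t in Ioc 0 h, |f t - g t|) + ∫ t in Ioi h, |f t - g t| := by
  have hi : IntegrableOn (fun t => |f t - g t|) (Ioi 0) := (hf.sub hg).abs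
  rw [l1dist, ← Ioc_union_Ioi_eq_Ioi hh, setIntegral_union (Ioc_disjoint_Ioi le_rfl)
    measurableSet_Ioi (hi.mono_set Ioc_subset_Ioi_self) (hi.mono_set (Ioi_subset_Ioi hh))]

theorem abs_integral_sub_le_l1dist {f g : ℝ → ℝ} (hf : IntegrableOn f (Ioi 0))
    (hg : IntegrableOn g (Ioi 0)) :
    |(∫ t in Ioi (0 : ℝ), f t) - ∫ t in Ioi (0 : ℝ), g t| ≤ l1dist f g := by
  rw [← integral_sub hf hg]
  exact abs_integral_le_integral_abs

theorem setIntegral_Ioi_comp_add_right (f : ℝ → ℝ) (a T : ℝ) :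
    ∫ t in Ioi a, f (t + T) = ∫ t in Ioi (a + T), f t := by
  have h := (measurePreserving_add_right (volume : Measure ℝ) T).setIntegral_preimage_emb
    (measurableEmbedding_addRight T) f (Ioi (a + T))
  simpa using h

theorem integrableOn_Ioi_comp_add_right_iff {f : ℝ → ℝ} {a T : ℝ} :
    IntegrableOn (fun t => f (t + T)) (Ioi a) ↔ IntegrableOn f (Ioi (a + T)) := by
  have h := (measurePreserving_add_right (volume : Measure ℝ) T).integrableOn_comp_preimage
    (measurableEmbedding_addRight T) (f := f) (s := Ioi (a + T))
  simpa [Function.comp_def] using h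

/-- Translation is continuous in `L¹`. -/
theorem tendsto_integral_abs_comp_add_sub {f : ℝ → ℝ} (hf : Integrable f) (h : ℝ) :
    Tendsto (fun a => ∫ t, |f (t + a) - f (t + h)|) (𝓝 h) (𝓝 0) := by
  have hm : MemLp f 1 (volume : Measure ℝ) := memLp_one_iff_integrable.2 hf
  have hc : Tendsto (fun a : ℝ => (DomAddAct.mk a +ᵥ hm.toLp f : Lp ℝ 1 (volume : Measure ℝ)))
      (𝓝 h) (𝓝 (DomAddAct.mk h +ᵥ hm.toLp f)) := by
    have : Continuous fun a : ℝ => (DomAddAct.mk a +ᵥ hm.toLp f : Lp ℝ 1 (volume : Measure ℝ)) := by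
      have : Fact ((1 : ENNReal) ≠ ⊤) := ⟨ENNReal.one_ne_top⟩
      have h1 : Continuous fun a : ℝ => DomAddAct.mk a := DomAddAct.continuous_mk
      exact h1.vadd continuous_const
    exact this.tendsto h
  rw [tendsto_iff_dist_tendsto_zero] at hc
  refine hc.congr fun a => ?_
  rw [dist_eq_norm, L1.norm_eq_integral_norm]
  refine integral_congr_ae ?_
  rw [DomAddAct.mk_vadd_toLp, DomAddAct.mk_vadd_toLp]
  filter_upwards [Lp.coeFn_sub (MemLp.toLp (fun x => f (a +ᵥ x)) (hm.comp_measurePreserving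
    (measurePreserving_vadd a _))) (MemLp.toLp (fun x => f (h +ᵥ x)) (hm.comp_measurePreserving
    (measurePreserving_vadd h _))), MemLp.coeFn_toLp (hm.comp_measurePreserving
    (measurePreserving_vadd a volume)), MemLp.coeFn_toLp (hm.comp_measurePreserving
    (measurePreserving_vadd h volume))] with t h1 h2 h3
  simp only [Function.comp_def, vadd_eq_add] at h1 h2 h3 ⊢
  rw [h1, Pi.sub_apply, h2, h3, Real.norm_eq_abs, add_comm a, add_comm h]

theorem IsDensity.integrableOn_Ioi {ρ : ℝ → ℝ} (hρ : IsDensity ρ) {T : ℝ} (hT : 0 ≤ T) :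
    IntegrableOn ρ (Ioi T) :=
  hρ.integrable.mono_set (Ioi_subset_Ioi hT)

theorem IsDensity.integral_Ioi_nonneg {ρ : ℝ → ℝ} (hρ : IsDensity ρ) {T : ℝ} (hT : 0 ≤ T) :
    0 ≤ ∫ t in Ioi T, ρ t :=
  setIntegral_nonneg measurableSet_Ioi fun t ht => hρ.nonneg t (hT.trans (le_of_lt ht))

theorem IsDensity.integral_Ioc_add {ρ : ℝ → ℝ} (hρ : IsDensity ρ) {T : ℝ} (hT : 0 ≤ T) :
    (∫ t in Ioc 0 T, ρ t) + ∫ t in Ioi T, ρ t = 1 := by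
  rw [← hρ.integral_eq_one, ← Ioc_union_Ioi_eq_Ioi hT, setIntegral_union (Ioc_disjoint_Ioi le_rfl)
    measurableSet_Ioi (hρ.integrable.mono_set Ioc_subset_Ioi_self) (hρ.integrableOn_Ioi hT)]

theorem IsDensity.integral_Ioi_le_one {ρ : ℝ → ℝ} (hρ : IsDensity ρ) {T : ℝ} (hT : 0 ≤ T) :
    ∫ t in Ioi T, ρ t ≤ 1 := by
  have h := hρ.integral_Ioc_add hT
  have : 0 ≤ ∫ t in Ioc 0 T, ρ t :=
    setIntegral_nonneg measurableSet_Ioc fun t ht => hρ.nonneg t ht.1.le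
  linarith

theorem IsDensity.shift {ρ : ℝ → ℝ} (hρ : IsDensity ρ) {T : ℝ} (hT : 0 ≤ T)
    (hpos : 0 < ∫ t in Ioi T, ρ t) : IsDensity (shift ρ T) where
  nonneg t ht := div_nonneg (hρ.nonneg _ (add_nonneg ht hT)) hpos.le
  integrable := (integrableOn_Ioi_comp_add_right_iff.2
    (by simpa using hρ.integrableOn_Ioi hT)).div_const _
  integral_eq_one := by
    simp only [TauberianGame.shift]
    rw [integral_div, setIntegral_Ioi_comp_add_right, zero_add, div_self hpos.ne']

theorem integral_Ioi_scale (ρ : ℝ → ℝ) {l : ℝ} (hl : 0 < l) (T : ℝ) :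
    ∫ t in Ioi T, scale ρ l t = ∫ t in Ioi (l * T), ρ t := by
  simp only [scale]
  rw [integral_const_mul, ← integral_comp_mul_left_Ioi' ρ T hl, smul_eq_mul]

theorem IsDensity.scale {ρ : ℝ → ℝ} (hρ : IsDensity ρ) {l : ℝ} (hl : 0 < l) :
    IsDensity (scale ρ l) where
  nonneg t ht := mul_nonneg hl.le (hρ.nonneg _ (mul_nonneg hl.le ht))
  integrable := ((integrableOn_Ioi_comp_mul_left_iff ρ 0 hl).2
    (by simpa using hρ.integrable)).const_mul _
  integral_eq_one := by rw [integral_Ioi_scale ρ hl, mul_zero, hρ.integral_eq_one]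

theorem scale_scale (ρ : ℝ → ℝ) (c l : ℝ) : scale (scale ρ c) l = scale ρ (c * l) := by
  funext t
  simp only [scale]
  rw [mul_assoc c l t]
  ring

theorem l1dist_scale (f g : ℝ → ℝ) {l : ℝ} (hl : 0 < l) :
    l1dist (scale f l) (scale g l) = l1dist f g := by
  have h := integral_Ioi_scale (fun t => |f t - g t|) hl 0
  rw [mul_zero] at h
  rw [l1dist, l1dist, ← h]
  congr 1 with t
  simp only [scale]
  rw [← mul_sub, abs_mul, abs_of_pos hl]

theorem shift_scale (ρ : ℝ → ℝ) {l : ℝ} (hl : 0 < l) (T : ℝ) :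
    shift (scale ρ l) T = scale (shift ρ (l * T)) l := by
  funext t
  simp only [shift, integral_Ioi_scale ρ hl]
  simp only [scale, shift]
  rw [mul_add, mul_div_assoc]

/-- Two proportional densities coincide. -/
theorem IsDensity.eqOn_of_proportional {ρ σ : ℝ → ℝ} (hρ : IsDensity ρ) (hσ : IsDensity σ) {C : ℝ}
    (h : ∀ t, 0 < t → ρ t = C * σ t) : EqOn ρ σ (Ioi 0) := by
  have hC : C = 1 := by
    rw [← hρ.integral_eq_one, setIntegral_congr_fun measurableSet_Ioi (fun t ht => h t ht),
      integral_const_mul, hσ.integral_eq_one, mul_one]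
  intro t ht
  rw [h t ht, hC, one_mul]

theorem l1dist_const_mul (f g : ℝ → ℝ) {c : ℝ} (hc : 0 ≤ c) :
    l1dist (fun t => c * f t) (fun t => c * g t) = c * l1dist f g := by
  simp only [l1dist, ← mul_sub, abs_mul, abs_of_nonneg hc, integral_const_mul]

theorem l1dist_const_mul_left {f : ℝ → ℝ} (hf : ∀ t, 0 < t → 0 ≤ f t) (a b : ℝ) :
    l1dist (fun t => a * f t) (fun t => b * f t) = |a - b| * ∫ t in Ioi (0 : ℝ), f t := by
  rw [l1dist, ← integral_const_mul]
  refine setIntegral_congr_fun measurableSet_Ioi fun t ht => ?_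
  rw [← sub_mul, abs_mul, abs_of_nonneg (hf t ht)]

theorem tendsto_l1dist_comp_add {ρ : ℝ → ℝ} (hρ : IntegrableOn ρ (Ioi 0)) {h : ℝ} (hh : 0 < h) :
    Tendsto (fun a => l1dist (fun t => ρ (t + a)) (fun t => ρ (t + h))) (𝓝 h) (𝓝 0) := by
  -- `ρ` is arbitrary on negative arguments, so it is cut off; for `a` near `h > 0` the cut-off is
  -- invisible on `(0, ∞)`.
  have hF : Integrable ((Ioi (0 : ℝ)).indicator ρ) := hρ.integrable_indicator measurableSet_Ioi
  refine squeeze_zero' (Eventually.of_forall fun a => l1dist_nonneg _ _) ?_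
    (tendsto_integral_abs_comp_add_sub hF h)
  filter_upwards [Ioi_mem_nhds hh] with a ha
  have hi : Integrable fun t =>
      |(Ioi (0 : ℝ)).indicator ρ (t + a) - (Ioi (0 : ℝ)).indicator ρ (t + h)| :=
    ((hF.comp_add_right a).sub (hF.comp_add_right h)).abs
  refine le_trans (le_of_eq ?_) (setIntegral_le_integral (s := Ioi 0) hi
    (Eventually.of_forall fun t => abs_nonneg _))
  refine setIntegral_congr_fun measurableSet_Ioi fun t ht => ?_
  rw [indicator_of_mem (mem_Ioi.2 (add_pos (mem_Ioi.1 ht) (mem_Ioi.1 ha))),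
    indicator_of_mem (mem_Ioi.2 (add_pos (mem_Ioi.1 ht) hh))]

theorem tendsto_integral_Ioi {ρ : ℝ → ℝ} (hρ : IntegrableOn ρ (Ioi 0)) {h : ℝ} (hh : 0 < h) :
    Tendsto (fun a => ∫ t in Ioi a, ρ t) (𝓝 h) (𝓝 (∫ t in Ioi h, ρ t)) := by
  rw [tendsto_iff_dist_tendsto_zero]
  refine squeeze_zero' (Eventually.of_forall fun a => dist_nonneg) ?_
    (tendsto_l1dist_comp_add hρ hh)
  filter_upwards [Ioi_mem_nhds hh] with a ha
  have hi : ∀ a : ℝ, 0 < a → IntegrableOn (fun t => ρ (t + a)) (Ioi 0) := fun a ha =>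
    integrableOn_Ioi_comp_add_right_iff.2 (hρ.mono_set (Ioi_subset_Ioi (by simpa using ha.le)))
  have := abs_integral_sub_le_l1dist (hi a ha) (hi h hh)
  simpa only [setIntegral_Ioi_comp_add_right, zero_add, Real.dist_eq] using this

theorem tendsto_l1dist_shift {ρ : ℝ → ℝ} (hρ : IsDensity ρ) {h : ℝ} (hh : 0 < h)
    (hpos : 0 < ∫ t in Ioi h, ρ t) :
    Tendsto (fun a => l1dist (shift ρ a) (shift ρ h)) (𝓝 h) (𝓝 0) := by
  have hM := tendsto_integral_Ioi hρ.integrable hh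
  have hlim : Tendsto (fun a => |(∫ t in Ioi a, ρ t)⁻¹ - (∫ t in Ioi h, ρ t)⁻¹| *
      (∫ t in Ioi a, ρ t) + (∫ t in Ioi h, ρ t)⁻¹ *
      l1dist (fun t => ρ (t + a)) (fun t => ρ (t + h))) (𝓝 h) (𝓝 0) := by
    have := (((hM.inv₀ hpos.ne').sub_const (∫ t in Ioi h, ρ t)⁻¹).abs.mul hM).add
      ((tendsto_l1dist_comp_add hρ.integrable hh).const_mul (∫ t in Ioi h, ρ t)⁻¹)
    simpa using this
  refine squeeze_zero' (Eventually.of_forall fun a => l1dist_nonneg _ _) ?_ hlim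
  filter_upwards [Ioi_mem_nhds hh] with a ha
  have hi : ∀ a : ℝ, 0 < a → IntegrableOn (fun t => ρ (t + a)) (Ioi 0) := fun a ha =>
    integrableOn_Ioi_comp_add_right_iff.2 (by simpa using hρ.integrableOn_Ioi ha.le)
  -- The intermediate function `ρ (t + a) / ∫_h^∞ ρ` separates the change of normalization from the
  -- translation.
  have h1 := l1dist_triangle ((hi a ha).const_mul (∫ t in Ioi a, ρ t)⁻¹)
    ((hi a ha).const_mul (∫ t in Ioi h, ρ t)⁻¹) ((hi h hh).const_mul (∫ t in Ioi h, ρ t)⁻¹)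
  rw [l1dist_const_mul_left fun t ht => hρ.nonneg _ (add_pos ht ha).le,
    l1dist_const_mul _ _ (inv_nonneg.2 hpos.le), setIntegral_Ioi_comp_add_right, zero_add] at h1
  exact (l1dist_congr (fun t _ => div_eq_inv_mul _ _) fun t _ => div_eq_inv_mul _ _).trans_le h1

end TauberianGame

namespace TauberianGame

/-! ### Nonexpansive values and the dynamic programming principle -/

theorem payoff_integrableOn {Ω : Type*} {g : Ω → ℝ} (hg : ∀ ω, g ω ∈ Icc (0 : ℝ) 1) {z : ℝ≥0 → Ω}
    (hz : AEMeasurable (fun t : ℝ => g (z t.toNNReal)) (volume.restrict (Ici 0)))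
    {ρ : ℝ → ℝ} (hρ : IntegrableOn ρ (Ioi 0)) :
    IntegrableOn (fun t => ρ t * g (z t.toNNReal)) (Ioi 0) := by
  refine Integrable.mul_bdd (c := 1) hρ ?_ (Eventually.of_forall fun t => ?_)
  · exact (hz.mono_measure (Measure.restrict_mono Ioi_subset_Ici_self le_rfl)).aestronglyMeasurable
  · rw [Real.norm_eq_abs, abs_of_nonneg (hg _).1]
    exact (hg _).2

theorem abs_payoff_sub_le {Ω : Type*} {g : Ω → ℝ} (hg : ∀ ω, g ω ∈ Icc (0 : ℝ) 1) {z : ℝ≥0 → Ω}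
    (hz : AEMeasurable (fun t : ℝ => g (z t.toNNReal)) (volume.restrict (Ici 0)))
    {ρ σ : ℝ → ℝ} (hρ : IntegrableOn ρ (Ioi 0)) (hσ : IntegrableOn σ (Ioi 0)) :
    |payoff g ρ z - payoff g σ z| ≤ l1dist ρ σ := by
  unfold payoff
  rw [← integral_sub (payoff_integrableOn hg hz hρ) (payoff_integrableOn hg hz hσ)]
  refine abs_integral_le_integral_abs.trans ?_
  refine integral_mono_of_nonneg (Eventually.of_forall fun t => abs_nonneg _) (hρ.sub hσ).abs
    (Eventually.of_forall fun t => ?_)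
  simp only
  rw [← sub_mul, abs_mul, abs_of_nonneg (hg _).1]
  exact mul_le_of_le_one_right (abs_nonneg _) (hg _).2

theorem isBdd_payoff {Ω : Type*} {K : Set (ℝ≥0 → Ω)} {g : Ω → ℝ} (hg : ∀ ω, g ω ∈ Icc (0 : ℝ) 1)
    (hmeas : ∀ z ∈ K, AEMeasurable (fun t : ℝ => g (z t.toNNReal)) (volume.restrict (Ici 0)))
    {ρ : ℝ → ℝ} (hρ : IntegrableOn ρ (Ioi 0)) : IsBdd fun z : K => payoff g ρ z := by
  refine ⟨l1dist ρ 0, fun z => ?_⟩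
  have h := abs_payoff_sub_le hg (hmeas z z.2) hρ (σ := 0) integrableOn_zero
  simpa [payoff] using h

/-- Monotonicity together with commutation with constants makes a game map nonexpansive: apply it to
`c₁ ≤ c₂ + D` and to the reverse inequality. -/
theorem IsGameMap.abs_sub_le {Ω : Type*} {K : Set (ℝ≥0 → Ω)} {V : (K → ℝ) → Ω → ℝ}
    (hV : IsGameMap V) {c₁ c₂ : K → ℝ} (h₁ : IsBdd c₁) (h₂ : IsBdd c₂) {D : ℝ}
    (h : ∀ z, |c₁ z - c₂ z| ≤ D) (ω : Ω) : |V c₁ ω - V c₂ ω| ≤ D := by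
  have key : ∀ {a b : K → ℝ}, IsBdd a → IsBdd b → (∀ z, a z ≤ b z + D) → V a ω ≤ V b ω + D := by
    intro a b ha hb hab
    have hbD : IsBdd fun z => 1 * b z + D := by
      obtain ⟨C, hC⟩ := hb
      refine ⟨C + |D|, fun z => (abs_add_le _ _).trans ?_⟩
      rw [one_mul]
      gcongr
      exact hC z
    have := hV.mono a _ ha hbD (fun z => by simpa using hab z) ω
    rwa [hV.affine b hb 1 D zero_le_one, one_mul] at this
  have k1 := key h₁ h₂ fun z => by linarith [(abs_le.1 (h z)).2]
  have k2 := key h₂ h₁ fun z => by linarith [(abs_le.1 (h z)).1]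
  rw [abs_le]
  constructor <;> linarith

theorem abs_value_sub_le {Ω : Type*} {K : Set (ℝ≥0 → Ω)} {g : Ω → ℝ}
    (hg : ∀ ω, g ω ∈ Icc (0 : ℝ) 1)
    (hmeas : ∀ z ∈ K, AEMeasurable (fun t : ℝ => g (z t.toNNReal)) (volume.restrict (Ici 0)))
    {V : (K → ℝ) → Ω → ℝ} (hV : IsGameMap V) {ρ σ : ℝ → ℝ} (hρ : IntegrableOn ρ (Ioi 0))
    (hσ : IntegrableOn σ (Ioi 0)) (ω : Ω) :
    |value V g ρ ω - value V g σ ω| ≤ l1dist ρ σ :=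
  hV.abs_sub_le (isBdd_payoff hg hmeas hρ) (isBdd_payoff hg hmeas hσ)
    (fun z => abs_payoff_sub_le hg (hmeas z z.2) hρ hσ) ω

theorem value_congr {Ω : Type*} {K : Set (ℝ≥0 → Ω)} (g : Ω → ℝ) (V : (K → ℝ) → Ω → ℝ)
    {ρ σ : ℝ → ℝ} (h : EqOn ρ σ (Ioi 0)) : value V g ρ = value V g σ := by
  unfold value payoff
  congr 1 with z
  exact setIntegral_congr_fun measurableSet_Ioi fun t ht => by simp only [h ht]

/-- Two densities that agree up to an integer time have values that differ by at most the
distance of the values of their continuations. -/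
theorem abs_value_sub_le_of_eqOn {Ω : Type*} {K : Set (ℝ≥0 → Ω)} {g : Ω → ℝ}
    (hg : ∀ ω, g ω ∈ Icc (0 : ℝ) 1)
    (hmeas : ∀ z ∈ K, AEMeasurable (fun t : ℝ => g (z t.toNNReal)) (volume.restrict (Ici 0)))
    {V : (K → ℝ) → Ω → ℝ} (hV : IsGameMap V) (hDPP : DiscreteDPP V g) {ρ σ : ℝ → ℝ}
    (hρ : IsDensity ρ) (hσ : IsDensity σ) {n : ℕ} (hn : 1 ≤ n)
    (hpos : 0 < ∫ t in Ioi (n : ℝ), ρ t) (heq : EqOn ρ σ (Ioc 0 (n : ℝ))) {D : ℝ}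
    (hD : ∀ ω, |value V g (shift ρ n) ω - value V g (shift σ n) ω| ≤ D) (ω : Ω) :
    |value V g ρ ω - value V g σ ω| ≤ D := by
  have hn0 : (0 : ℝ) ≤ n := n.cast_nonneg
  have htail : ∫ t in Ioi (n : ℝ), σ t = ∫ t in Ioi (n : ℝ), ρ t := by
    have h1 := hρ.integral_Ioc_add hn0
    have h2 := hσ.integral_Ioc_add hn0
    rw [setIntegral_congr_fun measurableSet_Ioc heq] at h1
    linarith
  have hbdd : ∀ {τ : ℝ → ℝ}, IsDensity τ → 0 < ∫ t in Ioi (n : ℝ), τ t →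
      IsBdd (stoppedPayoff V g τ (n : ℝ≥0)) := by
    intro τ hτ hτn
    obtain ⟨C, hC⟩ := hV.bounded _ (isBdd_payoff hg hmeas (hτ.shift hn0 hτn).integrable)
    refine ⟨1 + C, fun z => ?_⟩
    unfold stoppedPayoff
    refine (abs_add_le _ _).trans (add_le_add ?_ ?_)
    · refine abs_integral_le_integral_abs.trans ?_
      have hi : IntegrableOn τ (Ioc 0 ((n : ℝ≥0) : ℝ)) :=
        hτ.integrable.mono_set Ioc_subset_Ioi_self
      calc _ ≤ ∫ t in Ioc (0 : ℝ) ((n : ℝ≥0) : ℝ), τ t := by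
            refine setIntegral_mono_on ?_ hi measurableSet_Ioc fun t ht => ?_
            · exact ((payoff_integrableOn hg (hmeas z z.2) hτ.integrable).mono_set
                Ioc_subset_Ioi_self).abs
            · have := hτ.nonneg t ht.1.le
              rw [abs_of_nonneg (mul_nonneg this (hg _).1)]
              exact mul_le_of_le_one_right this (hg _).2
        _ ≤ 1 := by
            have := hτ.integral_Ioc_add hn0
            rw [NNReal.coe_natCast]
            linarith
    · rw [abs_mul, NNReal.coe_natCast, abs_of_pos hτn]
      refine (mul_le_of_le_one_left (abs_nonneg _) (hτ.integral_Ioi_le_one hn0)).trans ?_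
      exact hC _
  have hσpos : 0 < ∫ t in Ioi (n : ℝ), σ t := htail ▸ hpos
  unfold value
  -- In the stopped payoffs the parts collected up to `n` cancel; the continuations differ by at
  -- most `D` and carry a common weight of at most one.
  rw [← hDPP ρ hρ n hn hpos, ← hDPP σ hσ n hn hσpos]
  refine hV.abs_sub_le (hbdd hρ hpos) (hbdd hσ hσpos) (fun z => ?_) ω
  have hint : ∫ t in Ioc (0 : ℝ) ((n : ℝ≥0) : ℝ), ρ t * g (z.1 t.toNNReal) =
      ∫ t in Ioc (0 : ℝ) ((n : ℝ≥0) : ℝ), σ t * g (z.1 t.toNNReal) :=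
    setIntegral_congr_fun measurableSet_Ioc fun t ht => by
      simp only [heq (by simpa using ht)]
  unfold stoppedPayoff
  rw [hint, NNReal.coe_natCast, htail, add_sub_add_left_eq_sub, ← mul_sub, abs_mul,
    abs_of_pos hpos]
  exact (mul_le_of_le_one_left (abs_nonneg _) (hρ.integral_Ioi_le_one hn0)).trans (hD _)

/-! ### Tauberian densities: closedness and gluing -/

/-- A density `ρ` is Tauberian for `U` if the values of the games with payoffs averaged with
`scale ρ l` converge to `U` uniformly as `l → 0+`. -/
def IsTauberian {Ω : Type*} {K : Set (ℝ≥0 → Ω)} (V : (K → ℝ) → Ω → ℝ) (g : Ω → ℝ) (U : Ω → ℝ)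
    (ρ : ℝ → ℝ) : Prop :=
  IsDensity ρ ∧ TendstoUniformly (fun l : ℝ => value V g (scale ρ l)) U (𝓝[>] 0)

variable {Ω : Type*} {K : Set (ℝ≥0 → Ω)} {g : Ω → ℝ} {V : (K → ℝ) → Ω → ℝ} {U : Ω → ℝ}

theorem IsTauberian.eventually {ρ : ℝ → ℝ} (h : IsTauberian V g U ρ) {ε : ℝ} (hε : 0 < ε) :
    ∀ᶠ l in 𝓝[>] (0 : ℝ), ∀ ω, |value V g (scale ρ l) ω - U ω| < ε := by
  filter_upwards [Metric.tendstoUniformly_iff.1 h.2 ε hε] with l hl ω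
  rw [← Real.dist_eq, dist_comm]
  exact hl ω

theorem isTauberian_of_eventually {ρ : ℝ → ℝ} (hρ : IsDensity ρ)
    (h : ∀ ε > 0, ∀ᶠ l in 𝓝[>] (0 : ℝ), ∀ ω, |value V g (scale ρ l) ω - U ω| < ε) :
    IsTauberian V g U ρ := by
  refine ⟨hρ, Metric.tendstoUniformly_iff.2 fun ε hε => ?_⟩
  filter_upwards [h ε hε] with l hl ω
  rw [dist_comm, Real.dist_eq]
  exact hl ω

theorem tendsto_const_mul_nhdsGT_zero {c : ℝ} (hc : 0 < c) :
    Tendsto (fun l : ℝ => c * l) (𝓝[>] 0) (𝓝[>] 0) := by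
  refine tendsto_nhdsWithin_iff.2 ⟨?_, ?_⟩
  · have : Tendsto (fun l : ℝ => c * l) (𝓝 0) (𝓝 (c * 0)) := tendsto_id.const_mul c
    rw [mul_zero] at this
    exact this.mono_left nhdsWithin_le_nhds
  · filter_upwards [self_mem_nhdsWithin] with l hl using mul_pos hc hl

theorem IsTauberian.scale {ρ : ℝ → ℝ} (h : IsTauberian V g U ρ) {c : ℝ} (hc : 0 < c) :
    IsTauberian V g U (scale ρ c) := by
  refine ⟨h.1.scale hc, ?_⟩
  simp only [scale_scale]
  intro u hu
  exact (tendsto_const_mul_nhdsGT_zero hc).eventually (h.2 u hu)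

/-- Rescaling preserves the `L¹` distance, so approximating `ρ` by `σ` controls the values uniformly
in `l`. -/
theorem isTauberian_of_forall_l1dist_le (hg : ∀ ω, g ω ∈ Icc (0 : ℝ) 1)
    (hmeas : ∀ z ∈ K, AEMeasurable (fun t : ℝ => g (z t.toNNReal)) (volume.restrict (Ici 0)))
    (hV : IsGameMap V) {ρ : ℝ → ℝ} (hρ : IsDensity ρ)
    (h : ∀ ε > 0, ∃ σ, IsTauberian V g U σ ∧ l1dist ρ σ ≤ ε) : IsTauberian V g U ρ := by
  refine isTauberian_of_eventually hρ fun ε hε => ?_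
  obtain ⟨σ, hσ, hd⟩ := h (ε / 2) (by positivity)
  filter_upwards [hσ.eventually (half_pos hε), self_mem_nhdsWithin] with l hl hl0 ω
  have h1 := abs_value_sub_le hg hmeas hV (hρ.scale hl0).integrable (hσ.1.scale hl0).integrable ω
  rw [l1dist_scale _ _ hl0] at h1
  have h2 := abs_sub_le (value V g (TauberianGame.scale ρ l) ω)
    (value V g (TauberianGame.scale σ l) ω) (U ω)
  linarith [hl ω]

theorem IsTauberian.congr (hg : ∀ ω, g ω ∈ Icc (0 : ℝ) 1)
    (hmeas : ∀ z ∈ K, AEMeasurable (fun t : ℝ => g (z t.toNNReal)) (volume.restrict (Ici 0)))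
    (hV : IsGameMap V) {ρ σ : ℝ → ℝ} (hσ : IsTauberian V g U σ) (hρ : IsDensity ρ)
    (h : EqOn ρ σ (Ioi 0)) : IsTauberian V g U ρ :=
  isTauberian_of_forall_l1dist_le hg hmeas hV hρ fun _ hε =>
    ⟨σ, hσ, (l1dist_eq_zero_of_eqOn h).trans_le hε.le⟩

theorem tendsto_mul_floor_div {h : ℝ} (hh : 0 < h) :
    Tendsto (fun l : ℝ => l * (⌊h / l⌋₊ : ℝ)) (𝓝[>] 0) (𝓝 h) := by
  have h1 : Tendsto (fun l : ℝ => h - l) (𝓝[>] 0) (𝓝 h) := by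
    have : Tendsto (fun l : ℝ => h - l) (𝓝 0) (𝓝 (h - 0)) := tendsto_id.const_sub h
    rw [sub_zero] at this
    exact this.mono_left nhdsWithin_le_nhds
  refine tendsto_of_tendsto_of_tendsto_of_le_of_le' h1 tendsto_const_nhds ?_ ?_
  · filter_upwards [self_mem_nhdsWithin] with l (hl : 0 < l)
    have := Nat.lt_floor_add_one (h / l)
    rw [div_lt_iff₀ hl] at this
    linarith
  · filter_upwards [self_mem_nhdsWithin] with l (hl : 0 < l)
    have := Nat.floor_le (div_pos hh hl).le
    rw [le_div_iff₀ hl] at this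
    linarith

/-- If a density agrees on `(0, h]` with a Tauberian one, and both continuations after time `h`
are Tauberian, then the density is Tauberian. -/
theorem IsTauberian.of_eqOn_Ioc (hg : ∀ ω, g ω ∈ Icc (0 : ℝ) 1)
    (hmeas : ∀ z ∈ K, AEMeasurable (fun t : ℝ => g (z t.toNNReal)) (volume.restrict (Ici 0)))
    (hV : IsGameMap V) (hDPP : DiscreteDPP V g) {ρ σ : ℝ → ℝ} {h : ℝ} (hh : 0 < h)
    (hσ : IsTauberian V g U σ) (hσh : IsTauberian V g U (shift σ h))
    (hρ : IsDensity ρ) (hρh : IsTauberian V g U (shift ρ h)) (hpos : 0 < ∫ t in Ioi h, ρ t)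
    (heq : EqOn ρ σ (Ioc 0 h)) : IsTauberian V g U ρ := by
  have hσpos : 0 < ∫ t in Ioi h, σ t := by
    have h1 := hρ.integral_Ioc_add hh.le
    have h2 := hσ.1.integral_Ioc_add hh.le
    rw [setIntegral_congr_fun measurableSet_Ioc heq] at h1
    linarith
  refine isTauberian_of_eventually hρ fun ε hε => ?_
  -- The continuation of `scale τ l` after `⌊h / l⌋₊` is the `l`-rescaling of the shift of `τ` by `l
  -- * ⌊h / l⌋₊`, which is `L¹`-close to `shift τ h`. Used for both `ρ` and `σ`.
  have key : ∀ {τ : ℝ → ℝ}, IsDensity τ → IsTauberian V g U (shift τ h) →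
      0 < ∫ t in Ioi h, τ t → ∀ᶠ l in 𝓝[>] (0 : ℝ), 0 < ∫ t in Ioi (l * (⌊h / l⌋₊ : ℝ)), τ t ∧
        ∀ ω, |value V g (shift (TauberianGame.scale τ l) ⌊h / l⌋₊) ω - U ω| < ε / 4 := by
    intro τ hτ hτh hτpos
    have e1 := (tendsto_integral_Ioi hτ.integrable hh).comp (tendsto_mul_floor_div hh)
    have e2 := (tendsto_l1dist_shift hτ hh hτpos).comp (tendsto_mul_floor_div hh)
    filter_upwards [e1.eventually (lt_mem_nhds hτpos),
      e2.eventually (gt_mem_nhds (show 0 < ε / 8 by positivity)),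
      hτh.eventually (show 0 < ε / 8 by positivity), self_mem_nhdsWithin] with l l1 l2 l3 (l0 : 0 < l)
    refine ⟨l1, fun ω => ?_⟩
    rw [shift_scale _ l0]
    have hd := hτ.shift (mul_nonneg l0.le (Nat.cast_nonneg _)) l1
    have h1 := abs_value_sub_le hg hmeas hV (hd.scale l0).integrable
      (hτh.1.scale l0).integrable ω
    rw [l1dist_scale _ _ l0] at h1
    have h2 := abs_sub_le
      (value V g (TauberianGame.scale (shift τ (l * (⌊h / l⌋₊ : ℝ))) l) ω)
      (value V g (TauberianGame.scale (shift τ h) l) ω) (U ω)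
    have h3 := l3 ω
    simp only [Function.comp_apply] at l2
    linarith
  filter_upwards [key hρ hρh hpos, key hσ.1 hσh hσpos, hσ.eventually (half_pos hε),
    self_mem_nhdsWithin, Ioc_mem_nhdsGT hh] with l h1 h2 h3 (l0 : 0 < l) hlh ω
  -- The principle needs a stopping time of at least one, hence the restriction `l ≤ h`.
  have hn : 1 ≤ ⌊h / l⌋₊ := by
    rw [Nat.one_le_floor_iff, one_le_div l0]
    exact hlh.2
  have hle : (⌊h / l⌋₊ : ℝ) ≤ h / l := Nat.floor_le (div_pos hh l0).le
  rw [le_div_iff₀ l0] at hle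
  have := abs_value_sub_le_of_eqOn hg hmeas hV hDPP (hρ.scale l0) (hσ.1.scale l0) hn
    (by rw [integral_Ioi_scale _ l0]; exact h1.1) (D := ε / 2) (fun t ht => by
      have : l * t ∈ Ioc 0 h := ⟨mul_pos l0 ht.1, by nlinarith [ht.2]⟩
      simp only [TauberianGame.scale, heq this])
    (fun ω' => by
      have := abs_sub_le (value V g (shift (TauberianGame.scale ρ l) ⌊h / l⌋₊) ω') (U ω')
        (value V g (shift (TauberianGame.scale σ l) ⌊h / l⌋₊) ω')
      have h4 := h2.2 ω'
      rw [abs_sub_comm] at h4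
      linarith [h1.2 ω']) ω
  have h5 := abs_sub_le (value V g (TauberianGame.scale ρ l) ω)
    (value V g (TauberianGame.scale σ l) ω) (U ω)
  linarith [h3 ω]

end TauberianGame

namespace TauberianGame

/-! ### Concatenation and uniform densities -/

/-- The density that equals `σ` up to time `h` and continues as a multiple of `τ` afterwards. -/
noncomputable def cat (σ : ℝ → ℝ) (h : ℝ) (τ : ℝ → ℝ) : ℝ → ℝ := fun t =>
  if t ≤ h then σ t else (∫ s in Ioi h, σ s) * τ (t - h)

theorem cat_eqOn_Ioc (σ : ℝ → ℝ) (h : ℝ) (τ : ℝ → ℝ) : EqOn (cat σ h τ) σ (Ioc 0 h) :=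
  fun _ ht => if_pos ht.2

theorem cat_add (σ : ℝ → ℝ) (h : ℝ) (τ : ℝ → ℝ) {t : ℝ} (ht : 0 < t) :
    cat σ h τ (t + h) = (∫ s in Ioi h, σ s) * τ t := by
  rw [cat, if_neg (by linarith), add_sub_cancel_right]

theorem integrableOn_cat_Ioi {σ τ : ℝ → ℝ} {h : ℝ} (hτ : IsDensity τ) :
    IntegrableOn (cat σ h τ) (Ioi h) := by
  rw [← zero_add h, ← integrableOn_Ioi_comp_add_right_iff, zero_add]
  exact IntegrableOn.congr_fun (hτ.integrable.const_mul (∫ s in Ioi h, σ s))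
    (fun t ht => (cat_add σ h τ ht).symm) measurableSet_Ioi

theorem integral_cat_Ioi {σ τ : ℝ → ℝ} {h : ℝ} (hτ : IsDensity τ) :
    ∫ t in Ioi h, cat σ h τ t = ∫ t in Ioi h, σ t := by
  have h1 := setIntegral_Ioi_comp_add_right (cat σ h τ) 0 h
  rw [zero_add] at h1
  rw [← h1, setIntegral_congr_fun measurableSet_Ioi fun t ht => cat_add σ h τ ht,
    integral_const_mul, hτ.integral_eq_one, mul_one]

theorem IsDensity.cat {σ τ : ℝ → ℝ} {h : ℝ} (hσ : IsDensity σ) (hτ : IsDensity τ) (hh : 0 ≤ h) :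
    IsDensity (cat σ h τ) := by
  have hi : IntegrableOn (TauberianGame.cat σ h τ) (Ioc 0 h) :=
    (hσ.integrable.mono_set Ioc_subset_Ioi_self).congr_fun
      (fun t ht => (cat_eqOn_Ioc σ h τ ht).symm) measurableSet_Ioc
  have hi' : IntegrableOn (TauberianGame.cat σ h τ) (Ioi h) := integrableOn_cat_Ioi hτ
  refine ⟨fun t ht => ?_, ?_, ?_⟩
  · unfold TauberianGame.cat
    split_ifs with hth
    · exact hσ.nonneg t ht
    · exact mul_nonneg (hσ.integral_Ioi_nonneg hh) (hτ.nonneg _ (by linarith))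
  · rw [← Ioc_union_Ioi_eq_Ioi hh]
    exact hi.union hi'
  · rw [← Ioc_union_Ioi_eq_Ioi hh, setIntegral_union (Ioc_disjoint_Ioi le_rfl) measurableSet_Ioi
      hi hi', integral_cat_Ioi hτ, setIntegral_congr_fun measurableSet_Ioc (cat_eqOn_Ioc σ h τ),
      hσ.integral_Ioc_add hh]

theorem shift_cat_eqOn {σ τ : ℝ → ℝ} {h : ℝ} (hτ : IsDensity τ) (hpos : 0 < ∫ t in Ioi h, σ t) :
    EqOn (shift (cat σ h τ) h) τ (Ioi 0) := by
  intro t ht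
  rw [shift, integral_cat_Ioi hτ, cat_add σ h τ ht, mul_div_cancel_left₀ _ hpos.ne']

theorem l1dist_cat {ρ σ τ : ℝ → ℝ} {h : ℝ} (hρ : IsDensity ρ) (hσ : IsDensity σ)
    (hτ : IsDensity τ) (hh : 0 ≤ h) :
    l1dist ρ (cat σ h τ) = (∫ t in Ioc 0 h, |ρ t - σ t|) +
      l1dist (fun t => ρ (t + h)) fun t => (∫ s in Ioi h, σ s) * τ t := by
  rw [l1dist_eq_add hρ.integrable (hσ.cat hτ hh).integrable hh]
  congr 1
  · exact setIntegral_congr_fun measurableSet_Ioc fun t ht => by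
      simp only [cat_eqOn_Ioc σ h τ ht]
  · have h1 := setIntegral_Ioi_comp_add_right (fun t => |ρ t - cat σ h τ t|) 0 h
    rw [zero_add] at h1
    rw [← h1]
    exact setIntegral_congr_fun measurableSet_Ioi fun t ht => by
      simp only [cat_add σ h τ ht]

theorem uniformDensity_of_mem {T t : ℝ} (h0 : 0 ≤ t) (hT : t ≤ T) : uniformDensity T t = 1 / T :=
  indicator_of_mem (mem_Icc.2 ⟨h0, hT⟩) _

theorem uniformDensity_of_lt {T t : ℝ} (hT : T < t) : uniformDensity T t = 0 :=
  indicator_of_notMem (fun h => (hT.trans_le h.2).false) _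

theorem isDensity_uniformDensity {T : ℝ} (hT : 0 < T) : IsDensity (uniformDensity T) where
  nonneg t _ := indicator_nonneg (fun _ _ => by positivity) t
  integrable := by
    refine Integrable.integrableOn ?_
    unfold uniformDensity
    rw [integrable_indicator_iff measurableSet_Icc]
    exact integrableOn_const (by simp)
  integral_eq_one := by
    unfold uniformDensity
    rw [setIntegral_indicator measurableSet_Icc,
      show Ioi (0 : ℝ) ∩ Icc 0 T = Ioc 0 T from
        ext fun x => ⟨fun h => ⟨h.1, h.2.2⟩, fun h => ⟨h.1, h.1.le, h.2⟩⟩]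
    simp [hT.le, hT.ne']

theorem integral_uniformDensity_Ioi {T h : ℝ} (hT : 0 < T) (h0 : 0 ≤ h) (hh : h ≤ T) :
    ∫ t in Ioi h, uniformDensity T t = 1 - h / T := by
  have h1 := (isDensity_uniformDensity hT).integral_Ioc_add h0
  rw [setIntegral_congr_fun measurableSet_Ioc fun t ht =>
    uniformDensity_of_mem ht.1.le (ht.2.trans hh)] at h1
  simp [h0] at h1
  rw [div_eq_mul_inv]
  linarith

theorem uniformDensity_add {T h t : ℝ} (h0 : 0 ≤ h) (hh : h < T) (ht : 0 < t) :
    uniformDensity T (t + h) = (1 - h / T) * uniformDensity (T - h) t := by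
  have hT : 0 < T := h0.trans_lt hh
  by_cases htT : t ≤ T - h
  · rw [uniformDensity_of_mem (by linarith) (by linarith), uniformDensity_of_mem ht.le htT]
    have : T - h ≠ 0 := by linarith
    field_simp
  · rw [uniformDensity_of_lt (by linarith), uniformDensity_of_lt (not_le.1 htT), mul_zero]

theorem shift_uniformDensity_eqOn {T h : ℝ} (h0 : 0 ≤ h) (hh : h < T) :
    EqOn (shift (uniformDensity T) h) (uniformDensity (T - h)) (Ioi 0) := by
  intro t ht
  have hT : 0 < T := h0.trans_lt hh
  have : 1 - h / T ≠ 0 := by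
    rw [sub_ne_zero]
    exact ((div_lt_one hT).2 hh).ne'
  rw [shift, integral_uniformDensity_Ioi hT h0 hh.le, uniformDensity_add h0 hh ht,
    mul_div_cancel_left₀ _ this]

theorem scale_uniformDensity {l : ℝ} (hl : 0 < l) :
    scale (uniformDensity 1) l = uniformDensity (1 / l) := by
  funext t
  unfold scale uniformDensity
  by_cases ht : t ∈ Icc 0 (1 / l)
  · rw [indicator_of_mem ht, indicator_of_mem, one_div_one_div, div_one, mul_one]
    exact ⟨mul_nonneg hl.le ht.1, by have := (le_div_iff₀ hl).1 ht.2; linarith⟩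
  · rw [indicator_of_notMem ht, indicator_of_notMem, mul_zero]
    refine fun h => ht ⟨nonneg_of_mul_nonneg_right h.1 hl, ?_⟩
    rw [le_div_iff₀ hl]
    linarith [h.2]

theorem scale_uniformDensity_one_div {T : ℝ} (hT : 0 < T) :
    scale (uniformDensity 1) (1 / T) = uniformDensity T := by
  rw [scale_uniformDensity (by positivity), one_div_one_div]

variable {Ω : Type*} {K : Set (ℝ≥0 → Ω)} {g : Ω → ℝ} {V : (K → ℝ) → Ω → ℝ} {U : Ω → ℝ}

theorem IsTauberian.uniformDensity (hu : IsTauberian V g U (uniformDensity 1)) {T : ℝ}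
    (hT : 0 < T) : IsTauberian V g U (TauberianGame.uniformDensity T) := by
  rw [← scale_uniformDensity_one_div hT]
  exact hu.scale (by positivity)

theorem IsTauberian.cat (hg : ∀ ω, g ω ∈ Icc (0 : ℝ) 1)
    (hmeas : ∀ z ∈ K, AEMeasurable (fun t : ℝ => g (z t.toNNReal)) (volume.restrict (Ici 0)))
    (hV : IsGameMap V) (hDPP : DiscreteDPP V g) {σ τ : ℝ → ℝ} {h : ℝ} (hh : 0 < h)
    (hσ : IsTauberian V g U σ) (hσh : IsTauberian V g U (shift σ h))
    (hpos : 0 < ∫ t in Ioi h, σ t) (hτ : IsTauberian V g U τ) :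
    IsTauberian V g U (cat σ h τ) := by
  have hd := hσ.1.cat hτ.1 hh.le
  have hpos' : 0 < ∫ t in Ioi h, TauberianGame.cat σ h τ t := by rwa [integral_cat_Ioi hτ.1]
  exact .of_eqOn_Ioc hg hmeas hV hDPP hh hσ hσh hd
    (hτ.congr hg hmeas hV (hd.shift hh.le hpos') (shift_cat_eqOn hτ.1 hpos)) hpos'
    (cat_eqOn_Ioc σ h τ)

/-! ### Contraction towards the uniform density -/

/-- If a density with value `1` at `0+` and all its shifts are Tauberian, then so is the uniform
density: the distance from the uniform density to the set of Tauberian densities is contracted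
by concatenation with a short initial piece of the given density. -/
theorem isTauberian_uniformDensity_one (hg : ∀ ω, g ω ∈ Icc (0 : ℝ) 1)
    (hmeas : ∀ z ∈ K, AEMeasurable (fun t : ℝ => g (z t.toNNReal)) (volume.restrict (Ici 0)))
    (hV : IsGameMap V) (hDPP : DiscreteDPP V g) {σ : ℝ → ℝ} (hσ : IsTauberian V g U σ)
    (hlim : Tendsto σ (𝓝[>] 0) (𝓝 1))
    (hshift : ∀ δ, 0 < δ → 0 < (∫ t in Ioi δ, σ t) ∧ IsTauberian V g U (shift σ δ)) :
    IsTauberian V g U (uniformDensity 1) := by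
  set u := TauberianGame.uniformDensity 1 with hu
  have hud : IsDensity u := isDensity_uniformDensity one_pos
  set S : Set ℝ := (fun ν => l1dist u ν) '' {ν | IsTauberian V g U ν} with hS
  have hne : S.Nonempty := ⟨_, σ, hσ, rfl⟩
  have hbdd : BddBelow S := ⟨0, by rintro _ ⟨ν, -, rfl⟩; exact l1dist_nonneg _ _⟩
  have hsmall : ∀ ε : ℝ, 0 < ε → ε ≤ 1 / 2 → sInf S ≤ 4 * ε := by
    intro ε hε hε2
    obtain ⟨b, hb, hbs⟩ := mem_nhdsGT_iff_exists_Ioc_subset.1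
      (hlim.eventually (Metric.closedBall_mem_nhds 1 hε))
    set δ := min b (1 / 2) with hδ
    have hδ0 : 0 < δ := lt_min hb (by norm_num)
    have hδ1 : δ < 1 := (min_le_right _ _).trans_lt (by norm_num)
    have hσδ : ∀ t ∈ Ioc 0 δ, |1 - σ t| ≤ ε := fun t ht => by
      have : σ t ∈ Metric.closedBall 1 ε := hbs ⟨ht.1, ht.2.trans (min_le_left _ _)⟩
      rwa [Metric.mem_closedBall, Real.dist_eq, abs_sub_comm] at this
    obtain ⟨hM0, hsh⟩ := hshift δ hδ0
    have hfirst : ∫ t in Ioc 0 δ, |u t - σ t| ≤ ε * δ := by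
      have h1 : ∫ t in Ioc 0 δ, |u t - σ t| ≤ ∫ t in Ioc 0 δ, ε := by
        refine setIntegral_mono_on (IntegrableOn.mono_set (hud.integrable.sub hσ.1.integrable).abs
          Ioc_subset_Ioi_self) (integrableOn_const (by simp)) measurableSet_Ioc fun t ht => ?_
        rw [hu, uniformDensity_of_mem ht.1.le (ht.2.trans hδ1.le), div_one]
        exact hσδ t ht
      simpa [hδ0.le, mul_comm] using h1
    -- Total masses agree, so the tails after `δ` differ by exactly as much as the initial masses.
    have hmass : |1 - δ - ∫ t in Ioi δ, σ t| ≤ ε * δ := by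
      have h1 := hσ.1.integral_Ioc_add hδ0.le
      have h2 := hud.integral_Ioc_add hδ0.le
      rw [hu, integral_uniformDensity_Ioi one_pos hδ0.le hδ1.le, div_one] at h2
      have h3 : (∫ t in Ioc 0 δ, u t - σ t) = (∫ t in Ioc 0 δ, u t) - ∫ t in Ioc 0 δ, σ t :=
        integral_sub (hud.integrable.mono_set Ioc_subset_Ioi_self)
          (hσ.1.integrable.mono_set Ioc_subset_Ioi_self)
      have h4 : |∫ t in Ioc 0 δ, u t - σ t| ≤ ∫ t in Ioc 0 δ, |u t - σ t| :=
        abs_integral_le_integral_abs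
      rw [abs_sub_comm, show (∫ t in Ioi δ, σ t) - (1 - δ) = ∫ t in Ioc 0 δ, u t - σ t by
        rw [h3]; linarith]
      linarith
    set M := ∫ t in Ioi δ, σ t with hM
    have hκ : 0 < 1 / (1 - δ) := by
      have : 0 < 1 - δ := by linarith
      positivity
    -- After `δ`, `u` is `1 - δ` times the uniform density on `[0, 1 - δ]`, so `ν` is rescaled to
    -- that length before being glued to `σ`. One `ε * δ` comes from the initial piece, the other
    -- from the discrepancy between `1 - δ` and `M`.
    have hstep : ∀ ν, IsTauberian V g U ν → sInf S ≤ 2 * ε * δ + M * l1dist u ν := by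
      intro ν hν
      have hν' := hν.scale hκ
      have hcat := IsTauberian.cat hg hmeas hV hDPP hδ0 hσ hsh hM0 hν'
      refine (csInf_le hbdd ⟨_, hcat, rfl⟩).trans ?_
      simp only
      rw [l1dist_cat hud hσ.1 hν'.1 hδ0.le, ← hM]
      have hu' : EqOn (fun t => u (t + δ))
          (fun t => (1 - δ) * TauberianGame.scale u (1 / (1 - δ)) t) (Ioi 0) := by
        intro t ht
        simp only
        rw [hu, uniformDensity_add hδ0.le hδ1 ht, scale_uniformDensity_one_div (by linarith),
          div_one]
      rw [l1dist_congr hu' fun _ _ => rfl]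
      have hus := hud.scale hκ
      have h1 := l1dist_triangle (hus.integrable.const_mul (1 - δ)) (hus.integrable.const_mul M)
        (hν'.1.integrable.const_mul M)
      rw [l1dist_const_mul_left (fun t ht => hus.nonneg t (le_of_lt ht)),
        l1dist_const_mul _ _ hM0.le, l1dist_scale _ _ hκ, hus.integral_eq_one, mul_one] at h1
      linarith
    -- The infimum over `ν` gives `(1 - M) * sInf S ≤ 2 * ε * δ`; since `1 - M ≥ δ / 2`, the factor
    -- `δ` cancels.
    have hinf : (sInf S - 2 * ε * δ) / M ≤ sInf S := by
      refine le_csInf hne ?_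
      rintro _ ⟨ν, hν, rfl⟩
      rw [div_le_iff₀ hM0]
      linarith [hstep ν hν]
    rw [div_le_iff₀ hM0] at hinf
    have hS0 : 0 ≤ sInf S := le_csInf hne (by rintro _ ⟨ν, -, rfl⟩; exact l1dist_nonneg _ _)
    have h1 : δ / 2 ≤ 1 - M := by
      have := (abs_le.1 hmass).1
      nlinarith
    have h2 : δ * sInf S ≤ δ * (4 * ε) := by nlinarith
    exact le_of_mul_le_mul_left h2 hδ0
  refine isTauberian_of_forall_l1dist_le hg hmeas hV hud fun ε hε => ?_
  have hlt : sInf S < ε := by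
    refine (hsmall (min (ε / 8) (1 / 2)) (by positivity) (min_le_right _ _)).trans_lt ?_
    linarith [min_le_left (ε / 8) (1 / 2)]
  obtain ⟨_, ⟨ν, hν, rfl⟩, hlt'⟩ := exists_lt_of_csInf_lt hne hlt
  exact ⟨ν, hν, hlt'.le⟩

/-! ### From the uniform density to step densities -/

/-- For `c > 0` the uniform density on `[0, 1 / c]` has the same initial piece, and its continuation
is again uniform. For `c = 0` a very long uniform density supplies an approximate initial piece. -/
theorem isTauberian_of_const_on_Ioc (hg : ∀ ω, g ω ∈ Icc (0 : ℝ) 1)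
    (hmeas : ∀ z ∈ K, AEMeasurable (fun t : ℝ => g (z t.toNNReal)) (volume.restrict (Ici 0)))
    (hV : IsGameMap V) (hDPP : DiscreteDPP V g) (hu : IsTauberian V g U (uniformDensity 1))
    {ρ : ℝ → ℝ} {h c : ℝ} (hh : 0 < h) (hρ : IsDensity ρ) (hc : ∀ t ∈ Ioc 0 h, ρ t = c)
    (hpos : 0 < ∫ t in Ioi h, ρ t) (hρh : IsTauberian V g U (shift ρ h)) :
    IsTauberian V g U ρ := by
  have hT : ∀ T, h < T → IsTauberian V g U (TauberianGame.uniformDensity T) ∧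
      IsTauberian V g U (shift (TauberianGame.uniformDensity T) h) ∧
      0 < ∫ t in Ioi h, TauberianGame.uniformDensity T t := by
    intro T hT
    have hp : 0 < ∫ t in Ioi h, TauberianGame.uniformDensity T t := by
      rw [integral_uniformDensity_Ioi (hh.trans hT) hh.le hT.le, sub_pos,
        div_lt_one (hh.trans hT)]
      exact hT
    exact ⟨hu.uniformDensity (hh.trans hT), (hu.uniformDensity (sub_pos.2 hT)).congr hg hmeas hV
      ((isDensity_uniformDensity (hh.trans hT)).shift hh.le hp)
      (shift_uniformDensity_eqOn hh.le hT), hp⟩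
  have hmass := hρ.integral_Ioc_add hh.le
  rw [setIntegral_congr_fun measurableSet_Ioc hc] at hmass
  simp [hh.le] at hmass
  have hc0 : 0 ≤ c := hc h ⟨hh, le_rfl⟩ ▸ hρ.nonneg h hh.le
  rcases hc0.eq_or_lt with rfl | hc0
  · refine isTauberian_of_forall_l1dist_le hg hmeas hV hρ fun ε hε => ?_
    rw [mul_zero, zero_add] at hmass
    -- For a horizon `T` the distance is `2 * h / T`: `h / T` on the initial piece and `h / T` in
    -- the tail mass. This `T` makes it at most `ε`.
    have hlt : h < h + 2 * h / ε := by
      have : 0 < 2 * h / ε := by positivity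
      linarith
    obtain ⟨h1, h2, h3⟩ := hT _ hlt
    refine ⟨_, h1.cat hg hmeas hV hDPP hh h2 h3 hρh, ?_⟩
    set T := h + 2 * h / ε with hTd
    have hT0 : 0 < T := hh.trans hlt
    have e1 : ∫ t in Ioc 0 h, |ρ t - TauberianGame.uniformDensity T t| = h / T := by
      rw [setIntegral_congr_fun (g := fun _ => 1 / T) measurableSet_Ioc fun t ht => by
        simp only
        rw [hc t ht, uniformDensity_of_mem ht.1.le (ht.2.trans hlt.le), zero_sub, abs_neg,
          abs_of_pos (by positivity)]]
      simp [hh.le, div_eq_mul_inv]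
    have e2 : (fun t => ρ (t + h)) = fun t => 1 * shift ρ h t := by
      funext t
      rw [shift, hmass, div_one, one_mul]
    rw [l1dist_cat hρ h1.1 hρh.1 hh.le, e1, e2,
      l1dist_const_mul_left (fun t ht => hρh.1.nonneg t (le_of_lt ht)), hρh.1.integral_eq_one,
      mul_one, integral_uniformDensity_Ioi hT0 hh.le hlt.le, sub_sub_cancel,
      abs_of_pos (by positivity), ← two_mul, ← mul_div_assoc, div_le_iff₀ hT0, hTd, mul_add,
      mul_div_cancel₀ _ hε.ne']
    nlinarith
  -- Positive tail mass forces `h * c < 1`.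
  · have hlt : h < 1 / c := by
      rw [lt_div_iff₀ hc0]
      linarith
    obtain ⟨h1, h2, h3⟩ := hT _ hlt
    refine .of_eqOn_Ioc hg hmeas hV hDPP hh h1 h2 hρ hρh hpos fun t ht => ?_
    rw [hc t ht, uniformDensity_of_mem ht.1.le (ht.2.trans hlt.le), one_div_one_div]

/-- Induction on the number of steps: a shift by `h` removes the first one. -/
theorem isTauberian_of_step (hg : ∀ ω, g ω ∈ Icc (0 : ℝ) 1)
    (hmeas : ∀ z ∈ K, AEMeasurable (fun t : ℝ => g (z t.toNNReal)) (volume.restrict (Ici 0)))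
    (hV : IsGameMap V) (hDPP : DiscreteDPP V g) (hu : IsTauberian V g U (uniformDensity 1))
    {h : ℝ} (hh : 0 < h) (N : ℕ) :
    ∀ ρ : ℝ → ℝ, IsDensity ρ → (∀ k < N, ∃ c, ∀ t ∈ Ioc (k * h) ((k + 1) * h), ρ t = c) →
      (∀ t, N * h < t → ρ t = 0) → IsTauberian V g U ρ := by
  induction N with
  | zero =>
    intro ρ hρ _ h0
    have := hρ.integral_eq_one
    rw [setIntegral_congr_fun (g := fun _ => 0) measurableSet_Ioi
      fun t ht => h0 t (by simpa using ht)] at this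
    simp at this
  | succ N ih =>
    intro ρ hρ hstep h0
    obtain ⟨c, hc⟩ := hstep 0 N.succ_pos
    simp only [Nat.cast_zero, zero_mul, zero_add, one_mul] at hc
    -- If no mass remains after `h`, there is no continuation to normalize, but `ρ` is then a.e. the
    -- uniform density on `[0, h]`.
    rcases (hρ.integral_Ioi_nonneg hh.le).eq_or_lt with hM | hM
    · refine isTauberian_of_forall_l1dist_le hg hmeas hV hρ fun ε hε =>
        ⟨_, hu.uniformDensity hh, le_trans (le_of_eq ?_) hε.le⟩
      have hmass := hρ.integral_Ioc_add hh.le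
      rw [setIntegral_congr_fun measurableSet_Ioc hc, ← hM] at hmass
      simp [hh.le] at hmass
      rw [l1dist_eq_add hρ.integrable (isDensity_uniformDensity hh).integrable hh.le,
        setIntegral_congr_fun (g := fun _ => 0) measurableSet_Ioc fun t ht => by
          simp only
          rw [hc t ht, uniformDensity_of_mem ht.1.le ht.2, eq_div_of_mul_eq hh.ne'
            ((mul_comm c h).trans hmass), sub_self, abs_zero],
        setIntegral_congr_fun (g := ρ) measurableSet_Ioi fun t ht => by
          rw [uniformDensity_of_lt ht, sub_zero, abs_of_nonneg (hρ.nonneg t (hh.le.trans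
            (le_of_lt ht)))], ← hM]
      simp
    · refine isTauberian_of_const_on_Ioc hg hmeas hV hDPP hu hh hρ hc hM
        (ih _ (hρ.shift hh.le hM) (fun k hk => ?_) fun t ht => ?_)
      · obtain ⟨d, hd⟩ := hstep (k + 1) (Nat.succ_lt_succ hk)
        refine ⟨d / ∫ s in Ioi h, ρ s, fun t ht => ?_⟩
        rw [shift, hd]
        push_cast
        constructor <;> linarith [ht.1, ht.2]
      · rw [shift, h0, zero_div]
        push_cast
        linarith

end TauberianGame

namespace TauberianGame

/-! ### Density of step functions -/

theorem ceil_step_dist {h t : ℝ} (hh : 0 < h) :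
    h * ((⌈t / h⌉ : ℝ) - 1) < t ∧ t ≤ h * ((⌈t / h⌉ : ℝ) - 1) + h := by
  have h1 := Int.ceil_lt_add_one (t / h)
  have h2 := Int.le_ceil (t / h)
  rw [← sub_lt_iff_lt_add, lt_div_iff₀ hh] at h1
  rw [div_le_iff₀ hh] at h2
  constructor <;> linarith

/-- Densities that are constant on the intervals of a regular grid and vanish at infinity are dense
in the set of all densities. -/
theorem IsDensity.exists_step {ρ : ℝ → ℝ} (hρ : IsDensity ρ) {η : ℝ} (hη : 0 < η) :
    ∃ σ : ℝ → ℝ, IsDensity σ ∧ l1dist ρ σ ≤ η ∧ ∃ h : ℝ, 0 < h ∧ ∃ N : ℕ,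
      (∀ k < N, ∃ c, ∀ t ∈ Ioc (k * h) ((k + 1) * h), σ t = c) ∧ ∀ t, N * h < t → σ t = 0 := by
  -- Error budget: `ε` for the continuous approximation, `ε` for sampling it on the grid, `2 * ε`
  -- for normalizing. The bound `1 / 8` keeps the mass `m` positive.
  set ε := min (η / 4) (1 / 8) with hεd
  have hε : 0 < ε := by positivity
  have hF : Integrable ((Ioi (0 : ℝ)).indicator ρ) :=
    hρ.integrable.integrable_indicator measurableSet_Ioi
  obtain ⟨f, hfc, hfd, hf, hfi⟩ := hF.exists_hasCompactSupport_integral_sub_le hε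
  obtain ⟨R, hR0, hR⟩ : ∃ R : ℝ, 0 < R ∧ ∀ t, R < t → f t = 0 := by
    obtain ⟨r, hr⟩ := hfc.isCompact.isBounded.subset_closedBall 0
    refine ⟨max r 1, by positivity, fun t ht => image_eq_zero_of_notMem_tsupport fun h => ?_⟩
    have h1 := hr h
    rw [mem_closedBall_zero_iff, Real.norm_eq_abs] at h1
    linarith [le_abs_self t, le_max_left r 1]
  have hR1 : 0 < R + 1 := by linarith
  obtain ⟨δ, hδ, hfδ⟩ := Metric.uniformContinuousOn_iff.1
    ((isCompact_Icc (a := (0 : ℝ)) (b := R + 1)).uniformContinuousOn_of_continuous hf.continuousOn)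
    (ε / (R + 1)) (by positivity)
  obtain ⟨C, hC⟩ := (isCompact_Icc (a := (0 : ℝ)) (b := R + 1)).exists_bound_of_continuousOn
    hf.continuousOn
  set h := min (δ / 2) 1 with hhd
  have hh : 0 < h := by positivity
  have hhδ : h < δ := (min_le_left _ _).trans_lt (by linarith)
  have hh1 : h ≤ 1 := min_le_right _ _
  -- `p t` is the left end of the grid cell `(k * h, (k + 1) * h]` containing `t`. As `h ≤ 1`,
  -- sampling there extends the support at most to `R + 1`.
  set p : ℝ → ℝ := fun t => h * ((⌈t / h⌉ : ℝ) - 1) with hp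
  have hp1 : ∀ t, p t < t ∧ t ≤ p t + h := fun t => ceil_step_dist hh
  have hp0 : ∀ t, 0 < t → 0 ≤ p t := by
    intro t ht
    have : (1 : ℤ) ≤ ⌈t / h⌉ := Int.one_le_ceil_iff.2 (div_pos ht hh)
    have : (1 : ℝ) ≤ ⌈t / h⌉ := by exact_mod_cast this
    exact mul_nonneg hh.le (by linarith)
  -- Since `ρ ≥ 0`, taking the positive part of `f` does not increase the distance.
  set φ : ℝ → ℝ := fun t => max (f t) 0 with hφ
  set s : ℝ → ℝ := fun t => φ (p t) with hs
  have hφi : IntegrableOn φ (Ioi 0) := hfi.pos_part.integrableOn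
  have hs0 : ∀ t, 0 ≤ s t := fun t => le_max_right _ _
  have hφR : ∀ t, R + 1 < t → φ t = 0 := fun t ht => by
    simp only [hφ, hR t (by linarith), max_self]
  have hsR : ∀ t, R + 1 < t → s t = 0 := fun t ht => by
    simp only [hs, hφ, hR (p t) (by linarith [(hp1 t).2]), max_self]
  have hsm : Measurable s := by
    have : Measurable p :=
      ((measurable_from_top.comp (Int.measurable_ceil.comp (measurable_id.div_const h))).sub_const
        1).const_mul h
    exact (hf.measurable.comp this).max measurable_const
  have hsi : IntegrableOn s (Ioi 0) := by
    rw [← Ioc_union_Ioi_eq_Ioi hR1.le]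
    refine IntegrableOn.union (Measure.integrableOn_of_bounded (M := C) (by simp)
      hsm.aestronglyMeasurable ?_) (integrableOn_zero.congr_fun (fun t ht => (hsR t ht).symm)
      measurableSet_Ioi)
    refine (ae_restrict_iff' measurableSet_Ioc).2 (Eventually.of_forall fun t ht => ?_)
    have h1 := hC (p t) ⟨hp0 t ht.1, (hp1 t).1.le.trans ht.2⟩
    rw [Real.norm_eq_abs, abs_of_nonneg (hs0 t)]
    rw [Real.norm_eq_abs] at h1
    exact max_le ((le_abs_self _).trans h1) ((abs_nonneg _).trans h1)
  have d1 : l1dist ρ φ ≤ ε := by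
    refine le_trans ?_ hfd
    refine le_trans ?_ (setIntegral_le_integral (s := Ioi 0) (hF.sub hfi).norm
      (Eventually.of_forall fun t => norm_nonneg _))
    refine setIntegral_mono_on (hρ.integrable.sub hφi).abs (hF.sub hfi).norm.integrableOn
      measurableSet_Ioi fun t ht => ?_
    rw [indicator_of_mem ht, Real.norm_eq_abs]
    have := abs_max_sub_max_le_abs (ρ t) (f t) 0
    rwa [max_eq_left (hρ.nonneg t (le_of_lt ht))] at this
  have d2 : l1dist φ s ≤ ε := by
    rw [l1dist_eq_add hφi hsi hR1.le, setIntegral_congr_fun (g := fun _ => 0)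
      measurableSet_Ioi fun t ht => by
        simp only
        rw [hφR t ht, hsR t ht, sub_self, abs_zero]]
    have h1 : ∫ t in Ioc 0 (R + 1), |φ t - s t| ≤ ∫ t in Ioc 0 (R + 1), ε / (R + 1) := by
      refine setIntegral_mono_on (IntegrableOn.mono_set (hφi.sub hsi).abs Ioc_subset_Ioi_self)
        (integrableOn_const (by simp)) measurableSet_Ioc fun t ht => ?_
      refine (abs_max_sub_max_le_abs _ _ _).trans ?_
      rw [← Real.dist_eq]
      refine (hfδ t ⟨ht.1.le, ht.2⟩ (p t) ⟨hp0 t ht.1, (hp1 t).1.le.trans ht.2⟩ ?_).le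
      rw [Real.dist_eq, abs_of_pos (by linarith [(hp1 t).1])]
      linarith [(hp1 t).2]
    have h2 : ∫ t in Ioc 0 (R + 1), ε / (R + 1) = ε := by
      simp [hR1.le]
      field_simp
    simp only [integral_zero, add_zero]
    linarith
  have d3 : l1dist ρ s ≤ 2 * ε := by
    linarith [l1dist_triangle hρ.integrable hφi hsi]
  have hm : |1 - ∫ t in Ioi 0, s t| ≤ 2 * ε := by
    have := abs_integral_sub_le_l1dist hρ.integrable hsi
    rw [hρ.integral_eq_one] at this
    linarith
  set m := ∫ t in Ioi 0, s t with hmd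
  have hm0 : 0 < m := by
    have h1 := (abs_le.1 hm).2
    linarith [min_le_right (η / 4) (1 / 8 : ℝ)]
  refine ⟨fun t => m⁻¹ * s t, ⟨fun t _ => mul_nonneg (inv_nonneg.2 hm0.le) (hs0 t),
    hsi.const_mul _, ?_⟩, ?_, h, hh, ⌈(R + 1) / h⌉₊, fun k _ => ?_, fun t ht => ?_⟩
  · rw [integral_const_mul, inv_mul_cancel₀ hm0.ne']
  · have h1 := l1dist_triangle hρ.integrable hsi (hsi.const_mul m⁻¹)
    have h2 := l1dist_const_mul_left (fun t _ => hs0 t) 1 m⁻¹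
    simp only [one_mul] at h2
    rw [← hmd, ← abs_of_pos hm0, ← abs_mul, abs_of_pos hm0, sub_mul, inv_mul_cancel₀ hm0.ne',
      one_mul, abs_sub_comm] at h2
    have h3 : l1dist s (fun t => m⁻¹ * s t) ≤ 2 * ε := h2.trans_le hm
    linarith [min_le_left (η / 4) (1 / 8 : ℝ)]
  · refine ⟨m⁻¹ * φ (h * k), fun t ht => ?_⟩
    have : ⌈t / h⌉ = (k : ℤ) + 1 := by
      rw [Int.ceil_eq_iff]
      push_cast
      rw [lt_div_iff₀ hh, div_le_iff₀ hh, add_sub_cancel_right]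
      exact ht
    simp only [hs, hp, this]
    push_cast
    rw [add_sub_cancel_right]
  · have h1 := Nat.le_ceil ((R + 1) / h)
    rw [div_le_iff₀ hh] at h1
    simp only
    rw [hsR t (by linarith), mul_zero]

/-! ### Exponential, uniform and power densities -/

theorem IsDensity.integral_Ioi_pos {ρ : ℝ → ℝ} (hρ : IsDensity ρ) (hpos : ∀ t, 0 < t → 0 < ρ t)
    {T : ℝ} (hT : 0 ≤ T) : 0 < ∫ t in Ioi T, ρ t := by
  rw [setIntegral_pos_iff_support_of_nonneg_ae _ (hρ.integrableOn_Ioi hT)]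
  · rw [inter_eq_right.2 (show Ioi T ⊆ Function.support ρ from
      fun t ht => (hpos t (hT.trans_lt ht)).ne')]
    simp
  · exact (ae_restrict_iff' measurableSet_Ioi).2
      (Eventually.of_forall fun t ht => (hpos t (hT.trans_lt ht)).le)

theorem isDensity_expDensity_one : IsDensity (expDensity 1) where
  nonneg t _ := mul_nonneg zero_le_one (Real.exp_pos _).le
  integrable := by
    unfold expDensity
    simpa using integrableOn_exp_neg_Ioi 0
  integral_eq_one := by simpa [expDensity] using integral_exp_neg_Ioi_zero

theorem scale_expDensity_one (l : ℝ) : scale (expDensity 1) l = expDensity l := by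
  funext t
  simp [scale, expDensity]

/-- With `n = ⌊T⌋₊`, the gain on `[0, n]` equals the mass lost beyond `n`, so the distance is `2 *
(T - n) / T`. This links integer horizons to real ones. -/
theorem l1dist_uniformDensity_floor {T : ℝ} (hT : 1 ≤ T) :
    l1dist (uniformDensity T) (uniformDensity ⌊T⌋₊) ≤ 2 / T := by
  have hT0 : 0 < T := by linarith
  have hn : (1 : ℝ) ≤ ⌊T⌋₊ := by exact_mod_cast Nat.one_le_floor_iff _ |>.2 hT
  have hn0 : (0 : ℝ) < ⌊T⌋₊ := by linarith
  have hnT : (⌊T⌋₊ : ℝ) ≤ T := Nat.floor_le hT0.le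
  have hTn := Nat.lt_floor_add_one T
  rw [l1dist_eq_add (isDensity_uniformDensity hT0).integrable
    (isDensity_uniformDensity hn0).integrable hn0.le,
    setIntegral_congr_fun (g := fun _ => 1 / (⌊T⌋₊ : ℝ) - 1 / T) measurableSet_Ioc fun t ht => by
      simp only
      rw [uniformDensity_of_mem ht.1.le ht.2, uniformDensity_of_mem ht.1.le (ht.2.trans hnT),
        abs_sub_comm, abs_of_nonneg (sub_nonneg.2 (one_div_le_one_div_of_le hn0 hnT))],
    setIntegral_congr_fun (g := uniformDensity T) measurableSet_Ioi fun t ht => by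
      rw [uniformDensity_of_lt ht, sub_zero, abs_of_nonneg
        ((isDensity_uniformDensity hT0).nonneg t (hn0.le.trans (le_of_lt ht)))],
    integral_uniformDensity_Ioi hT0 hn0.le hnT, setIntegral_const]
  simp only [measureReal_def, Real.volume_Ioc, sub_zero, ENNReal.toReal_ofReal hn0.le, smul_eq_mul]
  have : (⌊T⌋₊ : ℝ) * (1 / (⌊T⌋₊ : ℝ) - 1 / T) + (1 - (⌊T⌋₊ : ℝ) / T) = 2 * (T - ⌊T⌋₊) / T := by
    field_simp
    ring
  rw [this]
  gcongr
  linarith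

/-- The shifts of a power density are its rescalings. -/
theorem shift_eqOn_scale_of_power {ρ : ℝ → ℝ} (hρ : IsDensity ρ) {α β γ : ℝ} (hα : 0 < α)
    (hβ : 0 < β) (hform : ∀ t, 0 ≤ t → ρ t = 1 / (α + β * t) ^ γ) {T : ℝ} (hT : 0 ≤ T) :
    EqOn (shift ρ T) (scale ρ (α / (α + β * T))) (Ioi 0) := by
  have hpos : ∀ t, 0 < t → 0 < ρ t := fun t ht => by
    rw [hform t ht.le]
    positivity
  have hM := hρ.integral_Ioi_pos hpos hT
  have hαT : 0 < α + β * T := by positivity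
  set l := α / (α + β * T) with hl
  have hl0 : 0 < l := by positivity
  refine (hρ.shift hT hM).eqOn_of_proportional (hρ.scale hl0)
    (C := l ^ γ / l / ∫ s in Ioi T, ρ s) fun t ht => ?_
  -- This identity makes the two densities proportional; equal mass then forces equality.
  have e1 : α + β * (l * t) = l * (α + β * (t + T)) := by
    rw [hl]
    field_simp
    ring
  have e2 : 0 < α + β * (t + T) := by positivity
  rw [shift, scale, hform _ (by positivity), hform (l * t) (by positivity), e1,
    Real.mul_rpow hl0.le e2.le]
  have e3 : 0 < l ^ γ := by positivity
  have e4 : 0 < (α + β * (t + T)) ^ γ := by positivity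
  field_simp

/-- The witness is `(1 + t) ^ (-2)`; it makes (q) non-vacuous, so that (q) implies (p). -/
theorem exists_isPowerDensity : ∃ ρ : ℝ → ℝ, IsPowerDensity ρ := by
  have hi : IntegrableOn (fun t : ℝ => (t + 1) ^ (-2 : ℝ)) (Ioi 0) :=
    integrableOn_add_rpow_Ioi_of_lt (by norm_num) (by norm_num)
  have he : EqOn (fun t : ℝ => (t + 1) ^ (-2 : ℝ)) (fun t => 1 / (1 + 1 * t) ^ (2 : ℝ))
      (Ioi 0) := fun t (ht : 0 < t) => by
    simp only
    rw [Real.rpow_neg (by linarith), one_mul, add_comm, one_div]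
  refine ⟨fun t => 1 / (1 + 1 * t) ^ (2 : ℝ), ⟨fun t ht => by positivity,
    hi.congr_fun he measurableSet_Ioi, ?_⟩, 1, 1, 2, one_pos, one_pos, two_pos, fun _ _ => rfl⟩
  rw [← setIntegral_congr_fun measurableSet_Ioi he,
    setIntegral_Ioi_comp_add_right (fun t : ℝ => t ^ (-2 : ℝ)),
    integral_Ioi_rpow_of_lt (by norm_num) (by norm_num)]
  norm_num

/-! ### Each condition in terms of Tauberian densities -/

variable {Ω : Type*} {K : Set (ℝ≥0 → Ω)} {g : Ω → ℝ} {V : (K → ℝ) → Ω → ℝ} {U : Ω → ℝ}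

/-- If the uniform density is Tauberian, then every density is. -/
theorem IsTauberian.of_uniformDensity (hg : ∀ ω, g ω ∈ Icc (0 : ℝ) 1)
    (hmeas : ∀ z ∈ K, AEMeasurable (fun t : ℝ => g (z t.toNNReal)) (volume.restrict (Ici 0)))
    (hV : IsGameMap V) (hDPP : DiscreteDPP V g)
    (hu : IsTauberian V g U (TauberianGame.uniformDensity 1)) {ρ : ℝ → ℝ} (hρ : IsDensity ρ) :
    IsTauberian V g U ρ := by
  refine isTauberian_of_forall_l1dist_le hg hmeas hV hρ fun ε hε => ?_
  obtain ⟨σ, hσ, hd, h, hh, N, hstep, h0⟩ := hρ.exists_step hε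
  exact ⟨σ, isTauberian_of_step hg hmeas hV hDPP hu hh N σ hσ hstep h0, hd⟩

theorem isTauberian_uniformDensity_of_nat (hg : ∀ ω, g ω ∈ Icc (0 : ℝ) 1)
    (hmeas : ∀ z ∈ K, AEMeasurable (fun t : ℝ => g (z t.toNNReal)) (volume.restrict (Ici 0)))
    (hV : IsGameMap V)
    (h : TendstoUniformly (fun n : ℕ => value V g (uniformDensity n)) U atTop) :
    IsTauberian V g U (uniformDensity 1) := by
  refine isTauberian_of_eventually (isDensity_uniformDensity one_pos) fun ε hε => ?_
  have h1 := (tendsto_nat_floor_atTop.comp (tendsto_inv_nhdsGT_zero (𝕜 := ℝ))).eventually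
    (Metric.tendstoUniformly_iff.1 h (ε / 2) (half_pos hε))
  -- Rounding the horizon `l⁻¹` down costs at most `2 * l`, which `l ≤ ε / 4` bounds by `ε / 2`.
  filter_upwards [h1, Ioc_mem_nhdsGT (show 0 < min 1 (ε / 4) by positivity)] with l hl hl' ω
  have hl0 : 0 < l := hl'.1
  have hl1 : l ≤ 1 := hl'.2.trans (min_le_left _ _)
  have hT : 1 ≤ l⁻¹ := (one_le_inv₀ hl0).2 hl1
  have hn : (0 : ℝ) < ⌊l⁻¹⌋₊ := by exact_mod_cast Nat.floor_pos.2 hT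
  have h2 := hl ω
  rw [dist_comm, Real.dist_eq] at h2
  simp only [Function.comp_apply] at h2
  have h3 := abs_value_sub_le hg hmeas hV (isDensity_uniformDensity (inv_pos.2 hl0)).integrable
    (isDensity_uniformDensity hn).integrable ω
  have h4 := l1dist_uniformDensity_floor hT
  rw [div_inv_eq_mul] at h4
  rw [scale_uniformDensity hl0, one_div]
  have h5 := abs_sub_le (value V g (uniformDensity l⁻¹) ω) (value V g (uniformDensity ⌊l⁻¹⌋₊) ω)
    (U ω)
  linarith [hl'.2.trans (min_le_right 1 (ε / 4))]

/-- The exponential density is memoryless: every shift is the density itself. -/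
theorem isTauberian_uniformDensity_of_exp (hg : ∀ ω, g ω ∈ Icc (0 : ℝ) 1)
    (hmeas : ∀ z ∈ K, AEMeasurable (fun t : ℝ => g (z t.toNNReal)) (volume.restrict (Ici 0)))
    (hV : IsGameMap V) (hDPP : DiscreteDPP V g)
    (h : TendstoUniformly (fun l : ℝ => value V g (expDensity l)) U (𝓝[>] 0)) :
    IsTauberian V g U (uniformDensity 1) := by
  have hσ : IsTauberian V g U (expDensity 1) :=
    ⟨isDensity_expDensity_one, by simpa only [scale_expDensity_one] using h⟩
  refine isTauberian_uniformDensity_one hg hmeas hV hDPP hσ ?_ fun δ hδ => ?_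
  · have hc : Continuous (expDensity 1) := by
      unfold expDensity
      fun_prop
    have := hc.tendsto 0
    simp only [expDensity, mul_zero, neg_zero, Real.exp_zero, mul_one] at this
    exact this.mono_left nhdsWithin_le_nhds
  · have hpos := hσ.1.integral_Ioi_pos (fun t _ => mul_pos one_pos (Real.exp_pos _)) hδ.le
    have hd := hσ.1.shift hδ.le hpos
    refine ⟨hpos, hσ.congr hg hmeas hV hd (hd.eqOn_of_proportional hσ.1
      (C := Real.exp (-δ) / ∫ s in Ioi δ, expDensity 1 s) fun t _ => ?_)⟩
    rw [shift, div_mul_eq_mul_div]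
    congr 1
    simp only [expDensity, one_mul]
    rw [← Real.exp_add]
    congr 1
    ring

/-- Shifting a power density by `T` rescales it by `l = α / (α + β * T)`, so `T → ∞` is the same
limit as `l → 0+`. -/
theorem isTauberian_uniformDensity_of_power (hg : ∀ ω, g ω ∈ Icc (0 : ℝ) 1)
    (hmeas : ∀ z ∈ K, AEMeasurable (fun t : ℝ => g (z t.toNNReal)) (volume.restrict (Ici 0)))
    (hV : IsGameMap V) (hDPP : DiscreteDPP V g) {ρ : ℝ → ℝ} (hρ : IsPowerDensity ρ)
    (h : TendstoUniformly (fun T : ℝ => value V g (shift ρ T)) U atTop) :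
    IsTauberian V g U (uniformDensity 1) := by
  obtain ⟨hρ, α, β, γ, hα, hβ, hγ, hform⟩ := hρ
  have hpos : ∀ t, 0 < t → 0 < ρ t := fun t ht => by
    rw [hform t ht.le]
    positivity
  have hT : IsTauberian V g U ρ := by
    refine ⟨hρ, fun u hu => ?_⟩
    -- This is `l = α / (α + β * T)` solved for `T`.
    have hlim : Tendsto (fun l : ℝ => (α * l⁻¹ - α) / β) (𝓝[>] 0) atTop :=
      (tendsto_atTop_add_const_right _ (-α)
        (tendsto_inv_nhdsGT_zero.const_mul_atTop hα)).atTop_div_const hβ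
    filter_upwards [hlim.eventually (h u hu), hlim.eventually (eventually_ge_atTop 0),
      self_mem_nhdsWithin] with l h1 h2 (hl : 0 < l)
    have e := value_congr g V (shift_eqOn_scale_of_power hρ hα hβ hform h2)
    rw [show α / (α + β * ((α * l⁻¹ - α) / β)) = l by field_simp; ring] at e
    rwa [e] at h1
  have hρ0 : 0 < ρ 0 := by
    rw [hform 0 le_rfl]
    positivity
  -- Rescaling by `(ρ 0)⁻¹` normalizes the value at zero to `1`.
  set c := (ρ 0)⁻¹ with hc
  have hc0 : 0 < c := inv_pos.2 hρ0
  refine isTauberian_uniformDensity_one hg hmeas hV hDPP (hT.scale hc0) ?_ fun δ hδ => ?_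
  · have h1 : Tendsto (fun t => c * (1 / (α + β * (c * t)) ^ γ)) (𝓝 0)
        (𝓝 (c * (1 / (α + β * (c * 0)) ^ γ))) := by
      have : ContinuousAt (fun t : ℝ => c * (1 / (α + β * (c * t)) ^ γ)) 0 := by
        refine continuousAt_const.mul (continuousAt_const.div ?_ ?_)
        · refine ContinuousAt.rpow_const (by fun_prop) (Or.inl ?_)
          simp [hα.ne']
        · simp only [mul_zero, add_zero]
          positivity
      exact this
    have h2 := hform 0 le_rfl
    rw [mul_zero] at h2
    rw [mul_zero, mul_zero, ← h2, hc, inv_mul_cancel₀ hρ0.ne'] at h1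
    refine (h1.mono_left nhdsWithin_le_nhds).congr' ?_
    filter_upwards [self_mem_nhdsWithin] with t (ht : 0 < t)
    rw [scale, hform (c * t) (by positivity)]
  · have hcδ : 0 < c * δ := by positivity
    have hp := hρ.integral_Ioi_pos hpos hcδ.le
    refine ⟨by rwa [integral_Ioi_scale _ hc0], ?_⟩
    rw [shift_scale _ hc0]
    exact ((hT.scale (by positivity)).congr hg hmeas hV (hρ.shift hcδ.le hp)
      (shift_eqOn_scale_of_power hρ hα hβ hform hcδ.le)).scale hc0

theorem IsTauberian.tendstoUniformly_shift {ρ : ℝ → ℝ} (hρ : IsPowerDensity ρ)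
    (h : IsTauberian V g U ρ) :
    TendstoUniformly (fun T : ℝ => value V g (shift ρ T)) U atTop := by
  obtain ⟨hρ, α, β, γ, hα, hβ, hγ, hform⟩ := hρ
  intro u hu
  have hlim : Tendsto (fun T : ℝ => α * (α + β * T)⁻¹) atTop (𝓝[>] 0) :=
    (tendsto_const_mul_nhdsGT_zero hα).comp (tendsto_inv_atTop_nhdsGT_zero.comp
      (tendsto_atTop_add_const_left _ α (tendsto_id.const_mul_atTop hβ)))
  filter_upwards [hlim.eventually (h.2 u hu), eventually_ge_atTop 0] with T h1 hT
  rwa [value_congr g V (shift_eqOn_scale_of_power hρ hα hβ hform hT)]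

theorem IsTauberian.tendstoUniformly_uniformDensity
    (h : IsTauberian V g U (TauberianGame.uniformDensity 1)) :
    TendstoUniformly (fun T : ℝ => value V g (TauberianGame.uniformDensity T)) U atTop := by
  intro u hu
  filter_upwards [tendsto_inv_atTop_nhdsGT_zero.eventually (h.2 u hu),
    eventually_gt_atTop 0] with T h1 hT
  rwa [← one_div, scale_uniformDensity_one_div hT] at h1

theorem piecewiseContinuous_of_continuous {ρ : ℝ → ℝ} (h : Continuous ρ) :
    PiecewiseContinuous ρ := by
  refine ⟨fun a b _ _ => ?_, fun t _ => ⟨⟨ρ t, (h.tendsto t).mono_left nhdsWithin_le_nhds⟩,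
    ⟨ρ t, (h.tendsto t).mono_left nhdsWithin_le_nhds⟩⟩⟩
  simp [h.continuousAt]

end TauberianGame

theorem mainTheorem3 {Ω : Type*} [Nonempty Ω] (K : Set (ℝ≥0 → Ω)) (hK : K.Nonempty)
    (g : Ω → ℝ) (hg : ∀ ω, g ω ∈ Icc (0 : ℝ) 1)
    (hmeas : ∀ z ∈ K, AEMeasurable (fun t : ℝ => g (z t.toNNReal)) (volume.restrict (Ici 0)))
    (V : (K → ℝ) → Ω → ℝ) (hV : IsGameMap V) (hDPP : DiscreteDPP V g)
    (hdisc : ∀ z ∈ K, ∀ n : ℕ, ∀ s : ℝ≥0, 0 < s → s < 1 → z (n + s) = z n)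
    (U : Ω → ℝ) (hU : ∀ ω, U ω ∈ Icc (0 : ℝ) 1) :
    List.TFAE [
      -- (u')
      TendstoUniformly (fun n : ℕ => value V g (uniformDensity n)) U atTop,
      -- (c)
      ∀ μ : ℝ → ℝ, IsDensity μ → PiecewiseContinuous μ →
        TendstoUniformly (fun l : ℝ => value V g (scale μ l)) U (𝓝[>] 0),
      -- (u)
      TendstoUniformly (fun T : ℝ => value V g (uniformDensity T)) U atTop,
      -- (e)
      TendstoUniformly (fun l : ℝ => value V g (expDensity l)) U (𝓝[>] 0),
      -- (p)
      ∃ ρ : ℝ → ℝ, IsPowerDensity ρ ∧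
        TendstoUniformly (fun T : ℝ => value V g (shift ρ T)) U atTop,
      -- (q)
      ∀ ρ : ℝ → ℝ, IsPowerDensity ρ →
        TendstoUniformly (fun T : ℝ => value V g (shift ρ T)) U atTop] := by
  -- The conditions link up in two cycles, 1 → 2 → 4 → 3 → 1 and 4 → 6 → 5 → 3 → 1 → 2 → 4; `hall`
  -- gives the passage from the uniform density to arbitrary ones.
  have hall : IsTauberian V g U (uniformDensity 1) → ∀ ρ, IsDensity ρ → IsTauberian V g U ρ :=
    fun hu ρ hρ => hu.of_uniformDensity hg hmeas hV hDPP hρ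
  tfae_have 1 → 2 := fun h ρ hρ _ =>
    (hall (isTauberian_uniformDensity_of_nat hg hmeas hV h) ρ hρ).2
  tfae_have 2 → 4 := fun h => by
    have := h (expDensity 1) isDensity_expDensity_one
      (piecewiseContinuous_of_continuous (by unfold expDensity; fun_prop))
    simpa only [scale_expDensity_one] using this
  tfae_have 4 → 3 := fun h =>
    (isTauberian_uniformDensity_of_exp hg hmeas hV hDPP h).tendstoUniformly_uniformDensity
  tfae_have 3 → 1 := fun h u hu => tendsto_natCast_atTop_atTop.eventually (h u hu)
  tfae_have 4 → 6 := fun h ρ hρ =>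
    (hall (isTauberian_uniformDensity_of_exp hg hmeas hV hDPP h) ρ hρ.1).tendstoUniformly_shift hρ
  tfae_have 6 → 5 := fun h => by
    obtain ⟨ρ, hρ⟩ := exists_isPowerDensity
    exact ⟨ρ, hρ, h ρ hρ⟩
  tfae_have 5 → 3 := fun ⟨ρ, hρ, h⟩ =>
    (isTauberian_uniformDensity_of_power hg hmeas hV hDPP hρ h).tendstoUniformly_uniformDensity
  tfae_finish
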